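/- Setting. Let $g=\mathrm{diag}(1,-1,-1,-1)$ on $\mathbb{R}^4$ and $x_\mu y^\mu=x^0y^0-x^1y^1-x^2y^2-x^3y^3$. The closed future (past) light-cone $LC^+$ ($LC^-$) is the set of $x$ with $x_\mu x^\mu\ge 0$ and $x^0\ge 0$ ($x^0\le 0$); $x$ is inside $LC^+$ if $x_\mu x^\mu>0$ and $x^0>0$. For a pair of Higgs doublets $\Phi=(\phi_1,\phi_2)\in\mathbb{C}^2\times\mathbb{C}^2$ let $r^\mu=(\phi_1^\dagger\phi_1+\phi_2^\dagger\phi_2,\ 2\,\mathrm{Re}\,\phi_1^\dagger\phi_2,\ 2\,\mathrm{Im}\,\phi_1^\dagger\phi_2,\ \phi_1^\dagger\phi_1-\phi_2^\dagger\phi_2)$. Let $\Lambda^{\mu\nu}$ be a real symmetric tensor that is positive definite on the future light-cone ($\Lambda_{\mu\nu}r^\mu r^\nu>0$ for all $r\in LC^+$, $r\ne0$), let $M^\mu\in\mathbb{R}^4$, and let $$V(\Phi)=-M_\mu r^\mu+\tfrac12\Lambda_{\mu\nu}r^\mu r^\nu .$$ A neutral (charge-breaking) stationary point is a vector $r^\mu$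 that comes from some $\Phi\neq0$ at which the derivative of $V$ with respect to the fields vanishes and whose doublets $\phi_1,\phi_2$ are linearly dependent (linearly independent); such points correspond to the electroweak orbits of stationary field configurations. Let $N(M)$ be the number of neutral stationary points and $N_{ch}(M)$ the number of charge-breaking ones. Statement. (1) If $M^\mu\notin LC^-$, then $N(M)\ge1$. (2) If $M^\mu$ is inside $LC^+$, then $N(M)\ge2$. Suppose moreover that the operator $r^\mu\mapsto\Lambda^{\mu\nu}r_\nu$ has three different eigenvalues $\Lambda_1<\Lambda_2<\Lambda_3$ with spacelike eigenvectors. For $i=1,2$ let the $i$-th caustic cone be $$C_i=\{\Lambda^{\mu\nu}r_\nu-l\,r^\mu:\ r_\mu r^\mu=0,\ r^0>0,\ \Lambda_i\le l\le\Lambda_{i+1}\};$$ "inside" $C_i$ means in the interior of $C_i$ and "outside" $C_i$ means not in its closure. Put $b(M)=2$ if $M^\mu$ is inside $LC^+$ and $b(M)=1$ otherwise. Then: (0) If $M^\mu\notin LC^-$ is outside both caustic cones, then $N(M)=b(M)$. (3) If $M^\mu$ is inside at least one of the caustic cones, then $N(M)\ge b(M)+2$; if it is inside one of them and outside the other, then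 $N(M)=b(M)+2$. (4) If $M^\mu$ is inside both caustic cones, then $N(M)=b(M)+4$. (5) For every $M^\mu$ one has $N(M)\le6$ and, if $\det\Lambda\ne0$, also $N_{ch}(M)\le1$. There is an $M^\mu$ inside $LC^+$ and inside both caustic cones with $N(M)=6$ and, if $\det\Lambda\neq0$, with $N_{ch}(M)=1$ as well. -/

import Mathlib

namespace TwoHiggs

/-- Four-vectors, with contravariant components `(x⁰, x¹, x², x³)`. -/
abbrev FourVec : Type := Fin 4 → ℝ

/-- The Minkowski metric `g = diag(1, -1, -1, -1)`. -/
def metric : Matrix (Fin 4) (Fin 4) ℝ := Matrix.diagonal ![1, -1, -1, -1]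

/-- The Minkowski product `x_μ y^μ = x⁰y⁰ - x¹y¹ - x²y² - x³y³`. -/
def mink (x y : FourVec) : ℝ := x ⬝ᵥ (metric.mulVec y)

/-- The closed future light-cone (surface and interior). -/
def futureCone : Set FourVec := {x | 0 ≤ x 0 ∧ 0 ≤ mink x x}

/-- The points inside the future light-cone. -/
def insideFutureCone : Set FourVec := {x | 0 < x 0 ∧ 0 < mink x x}

/-- The surface of the future light-cone, without its apex. -/
def futureNull : Set FourVec := {x | 0 < x 0 ∧ mink x x = 0}

/-- The closed past light-cone (surface and interior). -/
def pastCone : Set FourVec := {x | x 0 ≤ 0 ∧ 0 ≤ mink x x}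

/-- The mixed tensor `Λ^μ_ν = Λ^{μρ} g_{ρν}` of a tensor with contravariant components `Λ^{μν}`;
it maps `r^μ` to `Λ^{μν} r_ν`. -/
def mixed (Λ : Matrix (Fin 4) (Fin 4) ℝ) : Matrix (Fin 4) (Fin 4) ℝ := Λ * metric

/-- The quadratic form `Λ_{μν} r^μ r^ν = r_μ Λ^{μν} r_ν`. -/
def quartic (Λ : Matrix (Fin 4) (Fin 4) ℝ) (r : FourVec) : ℝ := mink r ((mixed Λ).mulVec r)

/-- `Λ` is positive definite on the future light-cone. -/
def PosDefOnFutureCone (Λ : Matrix (Fin 4) (Fin 4) ℝ) : Prop :=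
  ∀ r ∈ futureCone, r ≠ 0 → 0 < quartic Λ r

/-- A pair of Higgs doublets: `Φ 0` is `φ₁`, `Φ 1` is `φ₂`, each with its up and down component. -/
abbrev HiggsFields : Type := Fin 2 → Fin 2 → ℂ

/-- The electroweak scalar `φ_i† φ_j`. -/
def ewScalar (Φ : HiggsFields) (i j : Fin 2) : ℂ := star (Φ i) ⬝ᵥ Φ j

/-- The orbit-space four-vector `r^μ = Φ† σ^μ Φ` of a field configuration. Two configurations have
the same `r^μ` if and only if they have the same electroweak scalars, i.e. iff they lie on the same
electroweak orbit. All the complex numbers below are real. -/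
def orbitVec (Φ : HiggsFields) : FourVec :=
  ![(ewScalar Φ 0 0 + ewScalar Φ 1 1).re,
    (ewScalar Φ 1 0 + ewScalar Φ 0 1).re,
    (-Complex.I * (ewScalar Φ 0 1 - ewScalar Φ 1 0)).re,
    (ewScalar Φ 0 0 - ewScalar Φ 1 1).re]

/-- The Higgs potential `V = - M_μ r^μ + (1/2) Λ_{μν} r^μ r^ν` on the eight-dimensional real space
of Higgs fields. -/
noncomputable def potential (Λ : Matrix (Fin 4) (Fin 4) ℝ) (M : FourVec) (Φ : HiggsFields) : ℝ :=
  - mink M (orbitVec Φ) + (1 / 2) * quartic Λ (orbitVec Φ)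

/-- `Φ` is a stationary point of the Higgs potential in the space of Higgs fields. -/
def IsStationary (Λ : Matrix (Fin 4) (Fin 4) ℝ) (M : FourVec) (Φ : HiggsFields) : Prop :=
  HasFDerivAt (potential Λ M) (0 : HiggsFields →L[ℝ] ℝ) Φ

/-- The neutral stationary points: the points of the orbit space that come from a non-trivial
stationary configuration whose two doublets are proportional. -/
def neutralPoints (Λ : Matrix (Fin 4) (Fin 4) ℝ) (M : FourVec) : Set FourVec :=
  {r | ∃ Φ : HiggsFields, Φ ≠ 0 ∧ ¬ LinearIndependent ℂ Φ ∧ IsStationary Λ M Φ ∧ orbitVec Φ = r}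

/-- The charge-breaking stationary points: the points of the orbit space that come from a
stationary configuration whose two doublets are not proportional. -/
def chargedPoints (Λ : Matrix (Fin 4) (Fin 4) ℝ) (M : FourVec) : Set FourVec :=
  {r | ∃ Φ : HiggsFields, LinearIndependent ℂ Φ ∧ IsStationary Λ M Φ ∧ orbitVec Φ = r}

/-- `l` is an eigenvalue of `Λ^μ_ν` with a spacelike eigenvector. -/
def IsSpacelikeEigenvalue (Λ : Matrix (Fin 4) (Fin 4) ℝ) (l : ℝ) : Prop :=
  ∃ u : FourVec, mink u u < 0 ∧ (mixed Λ).mulVec u = l • u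

/-- The cone swept by the points `Λ^{μν} r_ν - ζ n^μ` with `r^μ = (v²/2) n^μ` on the future
light-cone, `v² > 0`, and `ζ` between `(v²/2) a` and `(v²/2) b`. With `l = ζ / (v²/2)` these are the
points `Λ^{μν} r_ν - l r^μ` with `a ≤ l ≤ b`. When `a < b` are consecutive spacelike eigenvalues,
this is a caustic cone. -/
def causticCone (Λ : Matrix (Fin 4) (Fin 4) ℝ) (a b : ℝ) : Set FourVec :=
  {x | ∃ r ∈ futureNull, ∃ l ∈ Set.Icc a b, x = (mixed Λ).mulVec r - l • r}

open Classical in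
/-- The number given by the position of `M` relative to the future light-cone: `2` inside it,
`1` otherwise. -/
noncomputable def baseNumber (M : FourVec) : ℕ∞ := if M ∈ insideFutureCone then 2 else 1

end TwoHiggs

/-! The fields enter only through `r`. Stationarity turns into two problems in Minkowski space, with
`A = mixed Λ`. Charge-breaking points solve `A r = M` with `r` inside the future cone. Neutral
points solve `A r - M = ζ r` with `r` future null and some multiplier `ζ` (`neutralPoints_eq`,
`chargedPoints_eq`). Positivity of `Λ` on the cone makes `A` diagonal in a Lorentz frame, with
timelike eigenvalue `l₀` above all spatial ones `lᵢ` (`exists_isEigenframe`).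

Let `M₀` be the time coordinate of `M` in this frame, `mᵢ` the ratios of its spatial coordinates to
`M₀`, `dᵢ = l₀ - lᵢ > 0`, `t = 1 / (l₀ - ζ)` and `n` the direction of `r`. For `M₀ ≠ 0` the neutral
equation reads `mᵢ = (1 - dᵢ t) nᵢ` with `|n| = 1`, and `r` is future-directed exactly when `M₀ t >
0`. Generically one therefore counts the roots of `F(t) = ∑ (mᵢ / (1 - dᵢ t))² = 1`.

The poles `1/d₀ < 1/d₁ < 1/d₂` cut the line into four intervals. On each of them `F` is strictly
convex (`not_between`), and it tends to `0` at `±∞`. The last interval always carries one root. The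
first carries a positive one iff `F(0) = ∑ mᵢ² < 1`, which for `M₀ > 0` means that `M` is inside the
light-cone. Each middle interval carries two roots as soon as `F < 1` somewhere on it. The caustic
cones consist of the `M` with `M₀ > 0` having a solution on a closed middle interval; in their
interiors `F < 1` occurs there, because the spatial part of `M` can be stretched slightly
(`hasShort_of_mem_interior`).

If some `mᵢ` vanishes, the pole disappears and solutions may sit at `t = 1/dᵢ`. Keeping the pairs
`(t, n)` and sorting them by weak sign patterns (`solutionBranch`) treats these cases together with
the generic one. -/

namespace TwoHiggs

/-! ### Algebra of the Minkowski product. -/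

theorem mink_eq (x y : FourVec) : mink x y = x 0 * y 0 - x 1 * y 1 - x 2 * y 2 - x 3 * y 3 := by
  simp [mink, metric, dotProduct, Fin.sum_univ_four, Matrix.mulVec_diagonal]
  ring

theorem mink_comm (x y : FourVec) : mink x y = mink y x := by
  rw [mink_eq, mink_eq]; ring

theorem mink_add_left (x y z : FourVec) : mink (x + y) z = mink x z + mink y z := by
  simp only [mink_eq, Pi.add_apply]; ring

theorem mink_add_right (x y z : FourVec) : mink x (y + z) = mink x y + mink x z := by
  simp only [mink_eq, Pi.add_apply]; ring

theorem mink_sub_left (x y z : FourVec) : mink (x - y) z = mink x z - mink y z := by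
  simp only [mink_eq, Pi.sub_apply]; ring

theorem mink_smul_left (a : ℝ) (x y : FourVec) : mink (a • x) y = a * mink x y := by
  simp only [mink_eq, Pi.smul_apply, smul_eq_mul]; ring

theorem mink_smul_right (a : ℝ) (x y : FourVec) : mink x (a • y) = a * mink x y := by
  simp only [mink_eq, Pi.smul_apply, smul_eq_mul]; ring

theorem eq_of_forall_mink {x y : FourVec} (h : ∀ z, mink z x = mink z y) : x = y := by
  funext i
  have := h (Pi.single i 1)
  fin_cases i <;> simpa [mink_eq] using this

/-- A symmetric tensor is self-adjoint for the Minkowski product. -/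
theorem mink_mixed {Λ : Matrix (Fin 4) (Fin 4) ℝ} (hs : Λ.IsSymm) (x y : FourVec) :
    mink x ((mixed Λ).mulVec y) = mink ((mixed Λ).mulVec x) y := by
  have h1 : ∀ x y : FourVec, mink x ((mixed Λ).mulVec y) =
      (metric.mulVec x) ⬝ᵥ Λ.mulVec (metric.mulVec y) := by
    intro x y
    rw [mink, mixed, ← Matrix.mulVec_mulVec, Matrix.dotProduct_mulVec, ← Matrix.mulVec_transpose]
    simp [metric]
  rw [mink_comm (Matrix.mulVec _ x), h1, h1, Matrix.dotProduct_mulVec, ← Matrix.mulVec_transpose,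
    hs.eq, dotProduct_comm]

/-! ### From stationary fields to equations in orbit space. -/

/-- The polarization of the quadratic map `orbitVec`. -/
noncomputable def orbitPol (Φ Ψ : HiggsFields) : FourVec :=
  orbitVec (Φ + Ψ) - orbitVec Φ - orbitVec Ψ

theorem orbitVec_zero (Φ : HiggsFields) : orbitVec Φ 0 =
    (Φ 0 0).re ^ 2 + (Φ 0 0).im ^ 2 + (Φ 0 1).re ^ 2 + (Φ 0 1).im ^ 2 +
    ((Φ 1 0).re ^ 2 + (Φ 1 0).im ^ 2 + (Φ 1 1).re ^ 2 + (Φ 1 1).im ^ 2) := by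
  simp [orbitVec, ewScalar, dotProduct, Fin.sum_univ_two]; ring

theorem orbitVec_one (Φ : HiggsFields) : orbitVec Φ 1 =
    2 * ((Φ 0 0).re * (Φ 1 0).re + (Φ 0 0).im * (Φ 1 0).im + (Φ 0 1).re * (Φ 1 1).re +
    (Φ 0 1).im * (Φ 1 1).im) := by
  simp [orbitVec, ewScalar, dotProduct, Fin.sum_univ_two]; ring

theorem orbitVec_two (Φ : HiggsFields) : orbitVec Φ 2 =
    2 * ((Φ 0 0).re * (Φ 1 0).im - (Φ 0 0).im * (Φ 1 0).re + (Φ 0 1).re * (Φ 1 1).im -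
    (Φ 0 1).im * (Φ 1 1).re) := by
  simp [orbitVec, ewScalar, dotProduct, Fin.sum_univ_two]; ring

theorem orbitVec_three (Φ : HiggsFields) : orbitVec Φ 3 =
    (Φ 0 0).re ^ 2 + (Φ 0 0).im ^ 2 + (Φ 0 1).re ^ 2 + (Φ 0 1).im ^ 2 -
    ((Φ 1 0).re ^ 2 + (Φ 1 0).im ^ 2 + (Φ 1 1).re ^ 2 + (Φ 1 1).im ^ 2) := by
  simp [orbitVec, ewScalar, dotProduct, Fin.sum_univ_two]; ring

theorem orbitVec_add_smul (Φ Ψ : HiggsFields) (s : ℝ) :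
    orbitVec (Φ + s • Ψ) = orbitVec Φ + s • orbitPol Φ Ψ + s ^ 2 • orbitVec Ψ := by
  funext i
  fin_cases i <;>
    simp [orbitPol, orbitVec_zero, orbitVec_one, orbitVec_two, orbitVec_three] <;> ring

theorem differentiable_orbitVec : Differentiable ℝ orbitVec := by
  have hre : ∀ i k, Differentiable ℝ (fun Φ : HiggsFields => (Φ i k).re) := fun i k =>
    Complex.reCLM.differentiable.comp (by fun_prop)
  have him : ∀ i k, Differentiable ℝ (fun Φ : HiggsFields => (Φ i k).im) := fun i k =>
    Complex.imCLM.differentiable.comp (by fun_prop)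
  rw [differentiable_pi]
  intro i
  fin_cases i <;>
    simp only [Fin.zero_eta, Fin.mk_one, Fin.reduceFinMk, orbitVec_zero, orbitVec_one,
      orbitVec_two, orbitVec_three] <;>
    fun_prop

theorem differentiable_potential (Λ : Matrix (Fin 4) (Fin 4) ℝ) (M : FourVec) :
    Differentiable ℝ (potential Λ M) := by
  have h : ∀ i, Differentiable ℝ (fun Φ => orbitVec Φ i) :=
    differentiable_pi.1 differentiable_orbitVec
  unfold potential quartic
  simp only [mink_eq, Matrix.mulVec, dotProduct, Fin.sum_univ_four]
  fun_prop

/-- Stationarity, tested on the polarization of the orbit map. -/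
theorem isStationary_iff_pol {Λ : Matrix (Fin 4) (Fin 4) ℝ} (hs : Λ.IsSymm) (M : FourVec)
    (Φ : HiggsFields) : IsStationary Λ M Φ ↔
      ∀ Ψ, mink ((mixed Λ).mulVec (orbitVec Φ) - M) (orbitPol Φ Ψ) = 0 := by
  have key : ∀ Ψ : HiggsFields, HasDerivAt (fun s : ℝ => potential Λ M (Φ + s • Ψ))
      (mink ((mixed Λ).mulVec (orbitVec Φ) - M) (orbitPol Φ Ψ)) 0 := by
    intro Ψ
    -- The orbit map is quadratic, so the potential along a line is a quartic polynomial in `s`;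
    -- only its linear coefficient matters at `s = 0`.
    obtain ⟨b, c, d, h⟩ : ∃ b c d : ℝ, ∀ s : ℝ, potential Λ M (Φ + s • Ψ) = potential Λ M Φ +
        s * mink ((mixed Λ).mulVec (orbitVec Φ) - M) (orbitPol Φ Ψ) + s ^ 2 * b + s ^ 3 * c +
        s ^ 4 * d := by
      generalize hr : orbitVec Φ = r
      generalize hp : orbitPol Φ Ψ = p
      generalize hq : orbitVec Ψ = q
      refine ⟨- mink M q + mink ((mixed Λ).mulVec r) q + 1 / 2 * quartic Λ p,
        mink ((mixed Λ).mulVec p) q, 1 / 2 * quartic Λ q, fun s => ?_⟩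
      have e1 : mink p ((mixed Λ).mulVec r) = mink ((mixed Λ).mulVec r) p := mink_comm _ _
      have e2 : mink q ((mixed Λ).mulVec r) = mink ((mixed Λ).mulVec r) q := mink_comm _ _
      have e3 : mink q ((mixed Λ).mulVec p) = mink ((mixed Λ).mulVec p) q := mink_comm _ _
      rw [potential, potential, orbitVec_add_smul, hr, hp, hq]
      simp only [quartic, mink_add_left, mink_add_right, mink_smul_left, mink_smul_right,
        Matrix.mulVec_add, Matrix.mulVec_smul, mink_sub_left]
      rw [e1, e2, e3, mink_mixed hs r p, mink_mixed hs r q, mink_mixed hs p q]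
      ring
    have h' : (fun s : ℝ => potential Λ M (Φ + s • Ψ)) = _ := funext h
    rw [h']
    have := (((((hasDerivAt_id (0 : ℝ)).mul_const
      (mink ((mixed Λ).mulVec (orbitVec Φ) - M) (orbitPol Φ Ψ))).const_add (potential Λ M Φ)).add
      ((hasDerivAt_pow 2 (0 : ℝ)).mul_const b)).add
      ((hasDerivAt_pow 3 (0 : ℝ)).mul_const c)).add ((hasDerivAt_pow 4 (0 : ℝ)).mul_const d)
    exact this.congr_deriv (by simp)
  have hline : ∀ Ψ : HiggsFields, HasDerivAt (fun s : ℝ => Φ + s • Ψ) Ψ 0 := fun Ψ => by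
    simpa using ((hasDerivAt_id (0 : ℝ)).smul_const Ψ).const_add Φ
  constructor
  · intro h Ψ
    have h0 : HasFDerivAt (potential Λ M) (0 : HiggsFields →L[ℝ] ℝ) (Φ + (0 : ℝ) • Ψ) := by
      rw [zero_smul, add_zero]; exact h
    exact (key Ψ).unique (h0.comp_hasDerivAt (f := fun s : ℝ => Φ + s • Ψ) (0 : ℝ) (hline Ψ))
  · intro h
    have h0 := (differentiable_potential Λ M Φ).hasFDerivAt
    have : fderiv ℝ (potential Λ M) Φ = 0 := by
      ext1 Ψ
      have h0' : HasFDerivAt (potential Λ M) (fderiv ℝ (potential Λ M) Φ) (Φ + (0 : ℝ) • Ψ) := by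
        simpa using h0
      have := (key Ψ).unique
        (h0'.comp_hasDerivAt (f := fun s : ℝ => Φ + s • Ψ) (0 : ℝ) (hline Ψ))
      rw [h Ψ] at this
      simpa using this.symm
    rwa [this] at h0

/-- The stationarity equations of the two doublets. -/
theorem isStationary_iff {Λ : Matrix (Fin 4) (Fin 4) ℝ} (hs : Λ.IsSymm) (M : FourVec)
    (Φ : HiggsFields) {K : FourVec} (hK : (mixed Λ).mulVec (orbitVec Φ) - M = K) :
    IsStationary Λ M Φ ↔ ∀ k,
      (K 0 - K 3) * (Φ 0 k).re = K 1 * (Φ 1 k).re + K 2 * (Φ 1 k).im ∧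
      (K 0 - K 3) * (Φ 0 k).im = K 1 * (Φ 1 k).im - K 2 * (Φ 1 k).re ∧
      (K 0 + K 3) * (Φ 1 k).re = K 1 * (Φ 0 k).re - K 2 * (Φ 0 k).im ∧
      (K 0 + K 3) * (Φ 1 k).im = K 1 * (Φ 0 k).im + K 2 * (Φ 0 k).re := by
  rw [isStationary_iff_pol hs, hK]
  constructor
  · intro h k
    -- The real and imaginary unit variations of the components form a real basis of the field
    -- space.
    have h1 := h (Pi.single 0 (Pi.single k 1))
    have h2 := h (Pi.single 0 (Pi.single k Complex.I))
    have h3 := h (Pi.single 1 (Pi.single k 1))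
    have h4 := h (Pi.single 1 (Pi.single k Complex.I))
    clear h hK
    fin_cases k <;>
    · simp [mink_eq, orbitPol, orbitVec_zero, orbitVec_one, orbitVec_two,
        orbitVec_three] at h1 h2 h3 h4 ⊢
      refine ⟨?_, ?_, ?_, ?_⟩
      · linear_combination h1 / 2
      · linear_combination h2 / 2
      · linear_combination h3 / 2
      · linear_combination h4 / 2
  · intro h Ψ
    obtain ⟨a1, a2, a3, a4⟩ := h 0
    obtain ⟨b1, b2, b3, b4⟩ := h 1
    clear h hK
    simp only [mink_eq, orbitPol, orbitVec_zero, orbitVec_one, orbitVec_two, orbitVec_three,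
      Pi.sub_apply, Pi.add_apply, Complex.add_re, Complex.add_im]
    linear_combination 2 * (Ψ 0 0).re * a1 + 2 * (Ψ 0 0).im * a2 + 2 * (Ψ 1 0).re * a3 +
      2 * (Ψ 1 0).im * a4 + 2 * (Ψ 0 1).re * b1 + 2 * (Ψ 0 1).im * b2 + 2 * (Ψ 1 1).re * b3 +
      2 * (Ψ 1 1).im * b4

theorem linearIndependent_iff_det (Φ : HiggsFields) :
    LinearIndependent ℂ Φ ↔ Φ 0 0 * Φ 1 1 - Φ 0 1 * Φ 1 0 ≠ 0 := by
  have h := Matrix.linearIndependent_rows_iff_isUnit (A := Matrix.of Φ)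
  rw [Matrix.isUnit_iff_isUnit_det, Matrix.det_fin_two, isUnit_iff_ne_zero] at h
  exact h

/-- The Minkowski square of the orbit vector measures the linear independence of the doublets. -/
theorem mink_orbitVec_self (Φ : HiggsFields) :
    mink (orbitVec Φ) (orbitVec Φ) = 4 * Complex.normSq (Φ 0 0 * Φ 1 1 - Φ 0 1 * Φ 1 0) := by
  rw [mink_eq, orbitVec_zero, orbitVec_one, orbitVec_two, orbitVec_three, Complex.normSq_apply]
  simp only [Complex.sub_re, Complex.sub_im, Complex.mul_re, Complex.mul_im]
  ring

theorem orbitVec_zero_pos {Φ : HiggsFields} (h : Φ ≠ 0) : 0 < orbitVec Φ 0 := by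
  by_contra hn
  apply h
  rw [orbitVec_zero] at hn
  have e : ∀ i k, (Φ i k).re ^ 2 = 0 ∧ (Φ i k).im ^ 2 = 0 := by
    intro i k
    fin_cases i <;> fin_cases k <;> constructor <;> simp only [Fin.zero_eta, Fin.mk_one] <;>
      nlinarith [sq_nonneg (Φ 0 0).re, sq_nonneg (Φ 0 0).im, sq_nonneg (Φ 0 1).re,
        sq_nonneg (Φ 0 1).im, sq_nonneg (Φ 1 0).re, sq_nonneg (Φ 1 0).im, sq_nonneg (Φ 1 1).re,
        sq_nonneg (Φ 1 1).im]
  funext i k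
  exact Complex.ext (by simpa using (e i k).1) (by simpa using (e i k).2)

/-- A point of the closed future cone encodes a positive semidefinite Hermitian `2 × 2` matrix with
diagonal `(r⁰ ± r³) / 2` and determinant a quarter of the Minkowski square. Such a matrix is a Gram
matrix, and its Cholesky factor gives the doublets; `φ₁ = 0` in the degenerate case `r⁰ + r³ = 0`.
-/
theorem exists_orbitVec_eq {r : FourVec} (h0 : 0 ≤ r 0) (h1 : 0 ≤ mink r r) :
    ∃ Φ : HiggsFields, orbitVec Φ = r := by
  rw [mink_eq] at h1
  have h3 : r 3 ^ 2 ≤ r 0 ^ 2 := by nlinarith [sq_nonneg (r 1), sq_nonneg (r 2)]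
  obtain ⟨h4, h5⟩ := abs_le.1 (abs_le_of_sq_le_sq h3 h0)
  rcases (by linarith : 0 ≤ r 0 + r 3).eq_or_lt with hz | hp
  · have e3 : r 3 = - r 0 := by linarith
    have e1 : r 1 = 0 := by
      rw [e3] at h1
      exact pow_eq_zero_iff two_ne_zero |>.1 (by nlinarith [sq_nonneg (r 1), sq_nonneg (r 2)])
    have e2 : r 2 = 0 := by
      rw [e3] at h1
      exact pow_eq_zero_iff two_ne_zero |>.1 (by nlinarith [sq_nonneg (r 1), sq_nonneg (r 2)])
    refine ⟨![0, ![(Real.sqrt (r 0) : ℂ), 0]], ?_⟩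
    have hs := Real.sq_sqrt h0
    funext i
    fin_cases i <;>
      simp [orbitVec_zero, orbitVec_one, orbitVec_two, orbitVec_three, hs, e1, e2, e3]
  · set a := Real.sqrt ((r 0 + r 3) / 2) with ha
    have ha2 : a ^ 2 = (r 0 + r 3) / 2 := Real.sq_sqrt (by linarith)
    have hap : 0 < a := Real.sqrt_pos.2 (by linarith)
    have hc : 0 ≤ (r 0 * r 0 - r 1 * r 1 - r 2 * r 2 - r 3 * r 3) / (2 * (r 0 + r 3)) := by
      positivity
    have hc2 := Real.sq_sqrt hc
    set c := Real.sqrt ((r 0 * r 0 - r 1 * r 1 - r 2 * r 2 - r 3 * r 3) / (2 * (r 0 + r 3)))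
    have hb : (r 1 / (2 * a)) ^ 2 + (r 2 / (2 * a)) ^ 2 + c ^ 2 = (r 0 - r 3) / 2 := by
      rw [hc2, div_pow, div_pow, mul_pow, ha2]
      field_simp
      ring
    refine ⟨![![(a : ℂ), 0], ![⟨r 1 / (2 * a), r 2 / (2 * a)⟩, (c : ℂ)]], ?_⟩
    funext i
    fin_cases i
    · simp [orbitVec_zero]
      linear_combination ha2 + hb
    · simp [orbitVec_one]
      field_simp
    · simp [orbitVec_two]
      field_simp
    · simp [orbitVec_three]
      linear_combination ha2 - hb

/-- Neutral stationary points are the points of the null cone where the gradient of the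
quadratic function of `r` is proportional to `r`. -/
theorem neutralPoints_eq {Λ : Matrix (Fin 4) (Fin 4) ℝ} (hs : Λ.IsSymm) (M : FourVec) :
    neutralPoints Λ M = {r | r ∈ futureNull ∧ ∃ ζ : ℝ, (mixed Λ).mulVec r - M = ζ • r} := by
  ext r
  simp only [neutralPoints, Set.mem_ofPred_eq, linearIndependent_iff_det, not_not]
  constructor
  · rintro ⟨Φ, h0, hd, hst, rfl⟩
    have hpos := orbitVec_zero_pos h0
    refine ⟨⟨hpos, by rw [mink_orbitVec_self, hd]; simp⟩, ?_⟩
    obtain ⟨K, hK⟩ : ∃ K, (mixed Λ).mulVec (orbitVec Φ) - M = K := ⟨_, rfl⟩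
    rw [isStationary_iff hs M Φ hK] at hst
    refine ⟨K 0 / orbitVec Φ 0, ?_⟩
    rw [hK]
    obtain ⟨a1, a2, a3, a4⟩ := hst 0
    obtain ⟨b1, b2, b3, b4⟩ := hst 1
    -- Contracting the field equations with the conjugate fields shows that `K` is parallel to the
    -- orbit vector. Linear dependence of the doublets is not needed for this.
    have e1 : K 1 * orbitVec Φ 0 = K 0 * orbitVec Φ 1 := by
      rw [orbitVec_zero, orbitVec_one]
      linear_combination (-(Φ 0 0).re) * a3 - (Φ 0 0).im * a4 - (Φ 1 0).re * a1 -
        (Φ 1 0).im * a2 - (Φ 0 1).re * b3 - (Φ 0 1).im * b4 - (Φ 1 1).re * b1 - (Φ 1 1).im * b2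
    have e2 : K 2 * orbitVec Φ 0 = K 0 * orbitVec Φ 2 := by
      rw [orbitVec_zero, orbitVec_two]
      linear_combination ((Φ 0 0).im) * a3 - (Φ 0 0).re * a4 - (Φ 1 0).im * a1 +
        (Φ 1 0).re * a2 + (Φ 0 1).im * b3 - (Φ 0 1).re * b4 - (Φ 1 1).im * b1 + (Φ 1 1).re * b2
    have e3 : K 3 * orbitVec Φ 0 = K 0 * orbitVec Φ 3 := by
      rw [orbitVec_zero, orbitVec_three]
      linear_combination (-(Φ 0 0).re) * a1 - (Φ 0 0).im * a2 + (Φ 1 0).re * a3 +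
        (Φ 1 0).im * a4 - (Φ 0 1).re * b1 - (Φ 0 1).im * b2 + (Φ 1 1).re * b3 + (Φ 1 1).im * b4
    funext i
    rw [Pi.smul_apply, smul_eq_mul, div_mul_eq_mul_div, eq_div_iff hpos.ne']
    fin_cases i
    · rfl
    · exact e1
    · exact e2
    · exact e3
  · rintro ⟨⟨h0, h1⟩, ζ, hζ⟩
    obtain ⟨Φ, rfl⟩ := exists_orbitVec_eq h0.le h1.ge
    rw [mink_orbitVec_self] at h1
    have hd : Φ 0 0 * Φ 1 1 - Φ 0 1 * Φ 1 0 = 0 := by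
      rw [← Complex.normSq_eq_zero]; linarith
    refine ⟨Φ, ?_, hd, ?_, rfl⟩
    · rintro rfl
      simp [orbitVec_zero] at h0
    rw [isStationary_iff hs M Φ hζ]
    have hre := congrArg Complex.re hd
    have him := congrArg Complex.im hd
    simp only [Complex.sub_re, Complex.sub_im, Complex.mul_re, Complex.mul_im, Complex.zero_re,
      Complex.zero_im] at hre him
    intro k
    simp only [Pi.smul_apply, smul_eq_mul, orbitVec_zero, orbitVec_one, orbitVec_two,
      orbitVec_three]
    clear hζ h0 h1 hd
    -- For `K = ζ r` the defect of each equation is `±2ζ` times the real or imaginary part of a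
    -- conjugated field component times the determinant of the doublets, which is zero.
    fin_cases k <;> simp only [Fin.zero_eta, Fin.mk_one] <;> refine ⟨?_, ?_, ?_, ?_⟩
    · linear_combination 2 * ζ * ((Φ 1 1).re * hre + (Φ 1 1).im * him)
    · linear_combination 2 * ζ * ((Φ 1 1).re * him - (Φ 1 1).im * hre)
    · linear_combination -2 * ζ * ((Φ 0 1).re * hre + (Φ 0 1).im * him)
    · linear_combination -2 * ζ * ((Φ 0 1).re * him - (Φ 0 1).im * hre)
    · linear_combination -2 * ζ * ((Φ 1 0).re * hre + (Φ 1 0).im * him)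
    · linear_combination -2 * ζ * ((Φ 1 0).re * him - (Φ 1 0).im * hre)
    · linear_combination 2 * ζ * ((Φ 0 0).re * hre + (Φ 0 0).im * him)
    · linear_combination 2 * ζ * ((Φ 0 0).re * him - (Φ 0 0).im * hre)

/-- Charge-breaking stationary points are the points inside the future light-cone where the
gradient of the quadratic function of `r` vanishes. -/
theorem chargedPoints_eq {Λ : Matrix (Fin 4) (Fin 4) ℝ} (hs : Λ.IsSymm) (M : FourVec) :
    chargedPoints Λ M = {r | r ∈ insideFutureCone ∧ (mixed Λ).mulVec r = M} := by
  ext r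
  simp only [chargedPoints, Set.mem_ofPred_eq, linearIndependent_iff_det]
  constructor
  · rintro ⟨Φ, hd, hst, rfl⟩
    have h0 : Φ ≠ 0 := by rintro rfl; simp at hd
    have hm : 0 < mink (orbitVec Φ) (orbitVec Φ) := by
      rw [mink_orbitVec_self]
      have := Complex.normSq_pos.2 hd
      linarith
    have hpos := orbitVec_zero_pos h0
    refine ⟨⟨hpos, hm⟩, ?_⟩
    obtain ⟨K, hK⟩ : ∃ K, (mixed Λ).mulVec (orbitVec Φ) - M = K := ⟨_, rfl⟩
    rw [isStationary_iff hs M Φ hK] at hst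
    rw [← sub_eq_zero, hK]
    obtain ⟨a1, a2, a3, a4⟩ := hst 0
    obtain ⟨b1, b2, b3, b4⟩ := hst 1
    have hn := Complex.normSq_pos.2 hd
    -- The equations make `(K⁰ - K³) φ₁` a complex multiple of `φ₂`, so its determinant with `φ₂`
    -- vanishes; likewise for `(K⁰ + K³) φ₂` and `φ₁`.
    have c1 : (((K 0 - K 3 : ℝ) : ℂ)) * (Φ 0 0 * Φ 1 1 - Φ 0 1 * Φ 1 0) = 0 := by
      apply Complex.ext
      · simp only [Complex.sub_re, Complex.sub_im, Complex.mul_re, Complex.mul_im, Complex.zero_re,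
          Complex.ofReal_re, Complex.ofReal_im]
        linear_combination (Φ 1 1).re * a1 - (Φ 1 1).im * a2 - (Φ 1 0).re * b1 + (Φ 1 0).im * b2
      · simp only [Complex.sub_re, Complex.sub_im, Complex.mul_re, Complex.mul_im, Complex.zero_im,
          Complex.ofReal_re, Complex.ofReal_im]
        linear_combination (Φ 1 1).im * a1 + (Φ 1 1).re * a2 - (Φ 1 0).im * b1 - (Φ 1 0).re * b2
    have c2 : (((K 0 + K 3 : ℝ) : ℂ)) * (Φ 0 0 * Φ 1 1 - Φ 0 1 * Φ 1 0) = 0 := by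
      apply Complex.ext
      · simp only [Complex.sub_re, Complex.sub_im, Complex.mul_re, Complex.mul_im, Complex.zero_re,
          Complex.ofReal_re, Complex.ofReal_im]
        linear_combination -(Φ 0 1).re * a3 + (Φ 0 1).im * a4 + (Φ 0 0).re * b3 - (Φ 0 0).im * b4
      · simp only [Complex.sub_re, Complex.sub_im, Complex.mul_re, Complex.mul_im, Complex.zero_im,
          Complex.ofReal_re, Complex.ofReal_im]
        linear_combination -(Φ 0 1).im * a3 - (Φ 0 1).re * a4 + (Φ 0 0).im * b3 + (Φ 0 0).re * b4
    have d1 : K 0 - K 3 = 0 := by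
      rcases mul_eq_zero.1 c1 with h | h
      · exact_mod_cast h
      · exact absurd h hd
    have d2 : K 0 + K 3 = 0 := by
      rcases mul_eq_zero.1 c2 with h | h
      · exact_mod_cast h
      · exact absurd h hd
    rw [orbitVec_zero] at hpos
    rw [d1] at a1 a2 b1 b2
    rw [d2] at a3 a4 b3 b4
    have k1 : K 1 = 0 := by
      apply (mul_eq_zero.1 (?_ : K 1 * _ = 0)).resolve_right hpos.ne'
      linear_combination (-(Φ 0 0).re) * a3 - (Φ 0 0).im * a4 - (Φ 1 0).re * a1 -
        (Φ 1 0).im * a2 - (Φ 0 1).re * b3 - (Φ 0 1).im * b4 - (Φ 1 1).re * b1 - (Φ 1 1).im * b2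
    have k2 : K 2 = 0 := by
      apply (mul_eq_zero.1 (?_ : K 2 * _ = 0)).resolve_right hpos.ne'
      linear_combination ((Φ 0 0).im) * a3 - (Φ 0 0).re * a4 - (Φ 1 0).im * a1 +
        (Φ 1 0).re * a2 + (Φ 0 1).im * b3 - (Φ 0 1).re * b4 - (Φ 1 1).im * b1 + (Φ 1 1).re * b2
    funext i
    fin_cases i
    · change K 0 = 0; linarith
    · exact k1
    · exact k2
    · change K 3 = 0; linarith
  · rintro ⟨⟨h0, h1⟩, hM⟩
    obtain ⟨Φ, rfl⟩ := exists_orbitVec_eq h0.le h1.le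
    refine ⟨Φ, ?_, ?_, rfl⟩
    · intro hd
      rw [mink_orbitVec_self, hd] at h1
      simp at h1
    · rw [isStationary_iff hs M Φ (K := 0) (by rw [hM, sub_self])]
      simp
-- Lorentz frames and diagonalization of the quartic tensor.
/-- A Lorentz frame: `u₀` is timelike and future-directed, the `uᵢ` are spacelike. -/
structure IsLorentzFrame (u₀ : FourVec) (u : Fin 3 → FourVec) : Prop where
  pos : 0 < u₀ 0
  unit : mink u₀ u₀ = 1
  orth₀ : ∀ i, mink u₀ (u i) = 0
  orth : ∀ i j, mink (u i) (u j) = if i = j then -1 else 0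

/-- A Lorentz frame of eigenvectors of `A`. -/
structure IsEigenframe (A : Matrix (Fin 4) (Fin 4) ℝ) (l₀ : ℝ) (l : Fin 3 → ℝ) (u₀ : FourVec)
    (u : Fin 3 → FourVec) : Prop extends IsLorentzFrame u₀ u where
  eig₀ : A.mulVec u₀ = l₀ • u₀
  eig : ∀ i, A.mulVec (u i) = l i • u i

theorem mink_sum_right {ι : Type*} (s : Finset ι) (x : FourVec) (f : ι → FourVec) :
    mink x (∑ i ∈ s, f i) = ∑ i ∈ s, mink x (f i) := by
  classical
  induction s using Finset.induction_on with
  | empty => simp [mink_eq]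
  | insert a s ha ih => rw [Finset.sum_insert ha, Finset.sum_insert ha, mink_add_right, ih]

theorem mink_sub_right (x y z : FourVec) : mink x (y - z) = mink x y - mink x z := by
  simp only [mink_eq, Pi.sub_apply]; ring

namespace IsLorentzFrame
variable {u₀ : FourVec} {u : Fin 3 → FourVec}

/-- Orthonormality says `W g Wᵀ g = 1` for the matrix `W` of frame vectors. A right inverse of a
square matrix is a left inverse, and `Wᵀ g W g = 1` is completeness. -/
theorem expand (h : IsLorentzFrame u₀ u) (x : FourVec) :
    x = mink u₀ x • u₀ + ∑ i, (-mink (u i) x) • u i := by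
  set W : Matrix (Fin 4) (Fin 4) ℝ := Matrix.of (Fin.cons u₀ u : Fin 4 → FourVec) with hW
  have hWr : ∀ (y : FourVec) a, ((W * metric).mulVec y) a =
      mink ((Fin.cons u₀ u : Fin 4 → FourVec) a) y := by
    intro y a
    rw [← Matrix.mulVec_mulVec]; rfl
  have h1 : (W * metric) * (W.transpose * metric) = 1 := by
    have h2 : (W * metric) * W.transpose = metric := by
      ext a b
      have : ((W * metric) * W.transpose) a b =
          mink ((Fin.cons u₀ u : Fin 4 → FourVec) a) ((Fin.cons u₀ u : Fin 4 → FourVec) b) := by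
        rw [← hWr]; rfl
      rw [this]
      refine Fin.cases ?_ (fun i => ?_) a <;> refine Fin.cases ?_ (fun j => ?_) b
      · simpa [metric] using h.unit
      · simpa [metric, Matrix.diagonal_apply, (Fin.succ_ne_zero j).symm] using h.orth₀ j
      · simpa [metric, Matrix.diagonal_apply, (Fin.succ_ne_zero i)] using
          (mink_comm _ _).trans (h.orth₀ i)
      · rw [Fin.cons_succ, Fin.cons_succ, h.orth i j]
        fin_cases i <;> fin_cases j <;> simp [metric]
    rw [← mul_assoc, h2]
    simp only [metric, Matrix.diagonal_mul_diagonal]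
    rw [← Matrix.diagonal_one]
    congr 1
    funext a
    fin_cases a <;> simp
  have h3 := mul_eq_one_comm.1 h1
  have h4 : x = (W.transpose * metric).mulVec ((W * metric).mulVec x) := by
    rw [Matrix.mulVec_mulVec, h3, Matrix.one_mulVec]
  have g0 : ((W * metric).mulVec x) 0 = mink u₀ x := hWr x 0
  have g1 : ((W * metric).mulVec x) 1 = mink (u 0) x := hWr x 1
  have g2 : ((W * metric).mulVec x) 2 = mink (u 1) x := hWr x 2
  have g3 : ((W * metric).mulVec x) 3 = mink (u 2) x := hWr x 3
  have w0 : W 0 = u₀ := rfl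
  have w1 : W 1 = u 0 := rfl
  have w2 : W 2 = u 1 := rfl
  have w3 : W 3 = u 2 := rfl
  conv_lhs => rw [h4]
  funext k
  rw [← Matrix.mulVec_mulVec, metric, Matrix.mulVec, dotProduct]
  simp only [Fin.sum_univ_four, Matrix.mulVec_diagonal, Matrix.transpose_apply]
  rw [← metric, g0, g1, g2, g3, w0, w1, w2, w3]
  simp [Fin.sum_univ_three]
  ring

theorem mink_eq_coords (h : IsLorentzFrame u₀ u) (x y : FourVec) :
    mink x y = mink u₀ x * mink u₀ y - ∑ i, (-mink (u i) x) * (-mink (u i) y) := by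
  conv_lhs => rw [h.expand y, mink_add_right, mink_sum_right]
  simp only [mink_smul_right]
  simp only [mink_comm x, neg_mul_neg]
  rw [sub_eq_add_neg, ← Finset.sum_neg_distrib]
  congr 1
  · ring
  · exact Finset.sum_congr rfl fun i _ => by ring

theorem ext (h : IsLorentzFrame u₀ u) {x y : FourVec} (h0 : mink u₀ x = mink u₀ y)
    (h1 : ∀ i, mink (u i) x = mink (u i) y) : x = y := by
  rw [h.expand x, h.expand y, h0]
  simp only [h1]

theorem mink_zero_combination (h : IsLorentzFrame u₀ u) (a : ℝ) (c : Fin 3 → ℝ) :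
    mink u₀ (a • u₀ + ∑ i, c i • u i) = a := by
  simp [mink_add_right, mink_sum_right, mink_smul_right, h.unit, h.orth₀]

theorem mink_combination (h : IsLorentzFrame u₀ u) (a : ℝ) (c : Fin 3 → ℝ) (j : Fin 3) :
    mink (u j) (a • u₀ + ∑ i, c i • u i) = - c j := by
  simp [mink_add_right, mink_sum_right, mink_smul_right, h.orth, mink_comm (u j) u₀, h.orth₀]

end IsLorentzFrame

/-- This is Cauchy–Schwarz for the spatial parts, whose lengths are bounded by the time components,
strictly for `u`. -/
theorem mink_pos_of_mem_futureCone {u y : FourVec} (hu : u ∈ insideFutureCone)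
    (hy : y ∈ futureCone) (h0 : y ≠ 0) : 0 < mink u y := by
  obtain ⟨u1, u2⟩ := hu
  obtain ⟨y1, y2⟩ := hy
  rw [mink_eq] at u2 y2 ⊢
  have hy0 : 0 < y 0 := by
    rcases y1.eq_or_lt with h | h
    · exfalso
      apply h0
      rw [← h] at y2
      funext i
      fin_cases i
      · exact h.symm
      all_goals
        refine pow_eq_zero_iff two_ne_zero |>.1 (le_antisymm ?_ (sq_nonneg _))
        simp only [Fin.mk_one, Fin.reduceFinMk]
        nlinarith [sq_nonneg (y 1), sq_nonneg (y 2), sq_nonneg (y 3)]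
    · exact h
  have hcs : (u 1 * y 1 + u 2 * y 2 + u 3 * y 3) ^ 2 ≤
      (u 1 ^ 2 + u 2 ^ 2 + u 3 ^ 2) * (y 1 ^ 2 + y 2 ^ 2 + y 3 ^ 2) := by
    nlinarith [sq_nonneg (u 1 * y 2 - u 2 * y 1), sq_nonneg (u 1 * y 3 - u 3 * y 1),
      sq_nonneg (u 2 * y 3 - u 3 * y 2)]
  have h2 : (u 1 ^ 2 + u 2 ^ 2 + u 3 ^ 2) * (y 1 ^ 2 + y 2 ^ 2 + y 3 ^ 2) < u 0 ^ 2 * y 0 ^ 2 := by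
    have : 0 < y 0 ^ 2 := by positivity
    calc _ ≤ (u 1 ^ 2 + u 2 ^ 2 + u 3 ^ 2) * y 0 ^ 2 := by gcongr; linarith
      _ < _ := by gcongr; linarith
  have h3 : (u 1 * y 1 + u 2 * y 2 + u 3 * y 3) ^ 2 < (u 0 * y 0) ^ 2 := by
    rw [mul_pow]; linarith
  have := abs_lt_of_sq_lt_sq h3 (by positivity)
  linarith [(abs_lt.1 this).2]

/-- The time orientation of a causal vector does not depend on the frame, so cone conditions may be
read in the eigenframe. -/
theorem IsLorentzFrame.time_pos_iff {u₀ : FourVec} {u : Fin 3 → FourVec}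
    (h : IsLorentzFrame u₀ u) {x : FourVec} (hx : 0 ≤ mink x x) : 0 < x 0 ↔ 0 < mink u₀ x := by
  have hu : u₀ ∈ insideFutureCone := ⟨h.pos, by rw [h.unit]; exact one_pos⟩
  constructor
  · intro h0
    exact mink_pos_of_mem_futureCone hu ⟨h0.le, hx⟩ (by rintro rfl; simp at h0)
  · intro h0
    by_contra hn
    have hne : -x ≠ 0 := by
      intro h'
      rw [neg_eq_zero.1 h'] at h0
      simp [mink_eq] at h0
    have h1 : -x ∈ futureCone := by
      refine ⟨by simpa using hn, ?_⟩
      rw [mink_eq] at hx ⊢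
      simpa using hx
    have := mink_pos_of_mem_futureCone hu h1 hne
    rw [show -x = (-1 : ℝ) • x by simp, mink_smul_right] at this
    linarith

/-- A boost: a timelike unit vector is part of a Lorentz frame. -/
theorem exists_isLorentzFrame {u₀ : FourVec} (h0 : 0 < u₀ 0) (h1 : mink u₀ u₀ = 1) :
    ∃ u, IsLorentzFrame u₀ u := by
  have h2 : 1 + u₀ 0 ≠ 0 := by positivity
  -- `k = 1 / (1 + γ)` with `γ = u₀ 0`; the vectors below are the spatial columns `(uᵢ, δᵢⱼ + uᵢ uⱼ
  -- / (1 + γ))` of the standard boost.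
  obtain ⟨k, hk⟩ : ∃ k, k * (1 + u₀ 0) = 1 := ⟨(1 + u₀ 0)⁻¹, inv_mul_cancel₀ h2⟩
  have h3 := h1
  rw [mink_eq] at h3
  have h4 : k * (u₀ 1 * u₀ 1 + u₀ 2 * u₀ 2 + u₀ 3 * u₀ 3) = u₀ 0 - 1 := by
    linear_combination (u₀ 0 - 1) * hk - k * h3
  refine ⟨fun i => ![![u₀ 1, 1 + k * u₀ 1 * u₀ 1, k * u₀ 1 * u₀ 2, k * u₀ 1 * u₀ 3],
    ![u₀ 2, k * u₀ 2 * u₀ 1, 1 + k * u₀ 2 * u₀ 2, k * u₀ 2 * u₀ 3],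
    ![u₀ 3, k * u₀ 3 * u₀ 1, k * u₀ 3 * u₀ 2, 1 + k * u₀ 3 * u₀ 3]] i, h0, h1, ?_, ?_⟩
  · intro i
    rw [mink_eq]
    fin_cases i <;> simp
    · linear_combination -(u₀ 1) * h4
    · linear_combination -(u₀ 2) * h4
    · linear_combination -(u₀ 3) * h4
  · intro i j
    rw [mink_eq]
    fin_cases i <;> fin_cases j <;> simp
    · linear_combination -(k * u₀ 1 * u₀ 1) * h4 - u₀ 1 * u₀ 1 * hk
    · linear_combination -(k * u₀ 1 * u₀ 2) * h4 - u₀ 1 * u₀ 2 * hk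
    · linear_combination -(k * u₀ 1 * u₀ 3) * h4 - u₀ 1 * u₀ 3 * hk
    · linear_combination -(k * u₀ 2 * u₀ 1) * h4 - u₀ 2 * u₀ 1 * hk
    · linear_combination -(k * u₀ 2 * u₀ 2) * h4 - u₀ 2 * u₀ 2 * hk
    · linear_combination -(k * u₀ 2 * u₀ 3) * h4 - u₀ 2 * u₀ 3 * hk
    · linear_combination -(k * u₀ 3 * u₀ 1) * h4 - u₀ 3 * u₀ 1 * hk
    · linear_combination -(k * u₀ 3 * u₀ 2) * h4 - u₀ 3 * u₀ 2 * hk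
    · linear_combination -(k * u₀ 3 * u₀ 3) * h4 - u₀ 3 * u₀ 3 * hk

/-- A tensor that is positive definite on the future light-cone has a timelike eigenvector. -/
theorem exists_timelike_eigenvector {Λ : Matrix (Fin 4) (Fin 4) ℝ} (hs : Λ.IsSymm)
    (hpos : PosDefOnFutureCone Λ) : ∃ (u₀ : FourVec) (l₀ : ℝ), 0 < u₀ 0 ∧ mink u₀ u₀ = 1 ∧
      0 < l₀ ∧ (mixed Λ).mulVec u₀ = l₀ • u₀ := by
  have cq : Continuous (quartic Λ) := by
    unfold quartic
    simp only [mink_eq, Matrix.mulVec, dotProduct, Fin.sum_univ_four]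
    fun_prop
  have cm : Continuous (fun x : FourVec => mink x x) := by
    simp only [mink_eq]; fun_prop
  set S : Set FourVec := {x | x 0 = 1 ∧ 0 ≤ mink x x} with hS
  have hScl : IsClosed S :=
    (isClosed_eq (continuous_apply 0) continuous_const).inter (isClosed_le continuous_const cm)
  have hSc : IsCompact S := by
    refine (isCompact_univ_pi (fun _ : Fin 4 =>
      isCompact_Icc (a := (-1 : ℝ)) (b := 1))).of_isClosed_subset hScl ?_
    rintro x ⟨h0, h1⟩ i -
    rw [mink_eq, h0] at h1
    rw [Set.mem_Icc, ← abs_le, ← sq_le_one_iff_abs_le_one]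
    fin_cases i <;> simp only [Fin.zero_eta, Fin.mk_one, Fin.reduceFinMk, h0] <;>
      nlinarith [sq_nonneg (x 1), sq_nonneg (x 2), sq_nonneg (x 3)]
  have hSf : ∀ x ∈ S, 0 < quartic Λ x := by
    rintro x ⟨h0, h1⟩
    exact hpos x ⟨by rw [h0]; exact zero_le_one, h1⟩ (by rintro rfl; simp at h0)
  have hSe : (Pi.single 0 1 : FourVec) ∈ S := by simp [hS, mink_eq]
  -- The quotient vanishes on the null boundary and is positive on the time axis, so its maximizer
  -- on the compact slice is timelike and can be varied in every direction.
  obtain ⟨x, hx, hmax⟩ := hSc.exists_isMaxOn ⟨_, hSe⟩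
    (f := fun x => mink x x / quartic Λ x)
    (cm.continuousOn.div cq.continuousOn (fun x hx => (hSf x hx).ne'))
  have hq := hSf x hx
  have hk : 0 < mink x x := by
    have h1 := hmax hSe
    have h2 : 0 < mink (Pi.single 0 1 : FourVec) (Pi.single 0 1) / quartic Λ (Pi.single 0 1) :=
      div_pos (by simp [mink_eq]) (hSf _ hSe)
    have h3 := h2.trans_le h1
    exact (div_pos_iff_of_pos_right hq).1 h3
  have hcone : ∀ y : FourVec, 0 < y 0 → 0 ≤ mink y y →
      mink y y * quartic Λ x ≤ mink x x * quartic Λ y := by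
    intro y hy0 hy1
    have hm : mink ((y 0)⁻¹ • y) ((y 0)⁻¹ • y) = (y 0)⁻¹ ^ 2 * mink y y := by
      rw [mink_smul_left, mink_smul_right]; ring
    have hqq : quartic Λ ((y 0)⁻¹ • y) = (y 0)⁻¹ ^ 2 * quartic Λ y := by
      rw [quartic, quartic, Matrix.mulVec_smul, mink_smul_left, mink_smul_right]; ring
    have hyS : (y 0)⁻¹ • y ∈ S := by
      refine ⟨by simp [hy0.ne'], ?_⟩
      rw [hm]; positivity
    have h1 := hmax hyS
    have h2 := hSf _ hyS
    simp only [Set.mem_ofPred_eq] at h1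
    rw [hm, hqq, mul_div_mul_left _ _ (by positivity)] at h1
    rw [hqq] at h2
    have h3 : 0 < quartic Λ y := pos_of_mul_pos_right h2 (by positivity)
    rwa [div_le_div_iff₀ h3 hq] at h1
  -- The first-order condition at the maximum is the eigenvalue equation tested against `h`.
  have hstat : ∀ h : FourVec, mink h ((mixed Λ).mulVec x) * mink x x = mink h x * quartic Λ x := by
    intro h
    set f : ℝ → ℝ := fun s => mink x x * quartic Λ (x + s • h) -
      mink (x + s • h) (x + s • h) * quartic Λ x with hf
    have hfe : ∀ s, f s = s * (2 * (mink h ((mixed Λ).mulVec x) * mink x x -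
        mink h x * quartic Λ x)) + s ^ 2 * (mink x x * quartic Λ h - mink h h * quartic Λ x) := by
      intro s
      simp only [hf, quartic, mink_add_left, mink_add_right, mink_smul_left, mink_smul_right,
        Matrix.mulVec_add, Matrix.mulVec_smul]
      rw [mink_mixed hs x h, mink_comm (Matrix.mulVec _ x) h, mink_comm x h]
      ring
    have hd : HasDerivAt f (2 * (mink h ((mixed Λ).mulVec x) * mink x x -
        mink h x * quartic Λ x)) 0 := by
      rw [show f = _ from funext hfe]
      exact (((hasDerivAt_id (0 : ℝ)).mul_const _).add ((hasDerivAt_pow 2 (0 : ℝ)).mul_const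
        _)).congr_deriv (by simp)
    have hmin : IsLocalMin f 0 := by
      have hc : Continuous (fun s : ℝ => x + s • h) := by fun_prop
      have e1 : ∀ᶠ s in nhds (0 : ℝ), 0 < (x + s • h) 0 := by
        refine ((continuous_apply 0).comp hc).continuousAt.eventually (lt_mem_nhds ?_)
        simp [hx.1]
      have e2 : ∀ᶠ s in nhds (0 : ℝ), 0 < mink (x + s • h) (x + s • h) := by
        refine (cm.comp hc).continuousAt.eventually (lt_mem_nhds ?_)
        simpa using hk
      filter_upwards [e1, e2] with s h1 h2
      have : f 0 = 0 := by rw [hfe]; ring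
      rw [this]
      exact sub_nonneg.2 (hcone _ h1 h2.le)
    have := hmin.hasDerivAt_eq_zero hd
    linarith
  have hA : (mixed Λ).mulVec x = (quartic Λ x / mink x x) • x := by
    refine eq_of_forall_mink fun z => ?_
    rw [mink_smul_right, div_mul_eq_mul_div, eq_div_iff hk.ne', hstat z, mul_comm]
  have hsq := Real.sqrt_pos.2 hk
  refine ⟨(Real.sqrt (mink x x))⁻¹ • x, quartic Λ x / mink x x, ?_, ?_, div_pos hq hk, ?_⟩
  · simp only [Pi.smul_apply, smul_eq_mul, hx.1]; positivity
  · rw [mink_smul_left, mink_smul_right, ← mul_assoc, ← mul_inv, Real.mul_self_sqrt hk.le,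
      inv_mul_cancel₀ hk.ne']
  · rw [Matrix.mulVec_smul, hA, smul_comm]

/-- A tensor that is positive definite on the future light-cone is diagonal in some Lorentz
frame, and the timelike eigenvalue is the largest one. -/
theorem exists_isEigenframe {Λ : Matrix (Fin 4) (Fin 4) ℝ} (hs : Λ.IsSymm)
    (hpos : PosDefOnFutureCone Λ) : ∃ l₀ l u₀ u, 0 < l₀ ∧ (∀ i, l i < l₀) ∧
      IsEigenframe (mixed Λ) l₀ l u₀ u := by
  obtain ⟨u₀, l₀, h0, h1, hl, hA⟩ := exists_timelike_eigenvector hs hpos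
  obtain ⟨v, hv⟩ := exists_isLorentzFrame h0 h1
  -- The Minkowski complement of `u₀` is negative definite and invariant, so the Euclidean spectral
  -- theorem applies to the symmetric matrix of the restriction.
  set S : Matrix (Fin 3) (Fin 3) ℝ := fun i j => -mink (v i) ((mixed Λ).mulVec (v j)) with hSdef
  have hS : S.IsHermitian := by
    refine Matrix.IsHermitian.ext fun i j => ?_
    simp only [hSdef, star_trivial]
    rw [mink_mixed hs, mink_comm]
  set O : Fin 3 → Fin 3 → ℝ := fun i k => (hS.eigenvectorBasis k) i with hO
  have hOO : ∀ k k', ∑ i, O i k * O i k' = if k = k' then 1 else 0 := by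
    intro k k'
    have := orthonormal_iff_ite.1 hS.eigenvectorBasis.orthonormal k' k
    rw [PiLp.inner_apply] at this
    simp only [RCLike.inner_apply, conj_trivial] at this
    simp only [hO, this, eq_comm]
  have hSO : ∀ i k, ∑ j, S i j * O j k = hS.eigenvalues k * O i k := by
    intro i k
    have := congrFun (hS.mulVec_eigenvectorBasis k) i
    simpa [Matrix.mulVec, dotProduct] using this
  have hAv : ∀ j, (mixed Λ).mulVec (v j) = ∑ i, S i j • v i := by
    intro j
    conv_lhs => rw [hv.expand ((mixed Λ).mulVec (v j))]
    rw [mink_mixed hs, hA, mink_smul_left, hv.orth₀]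
    simp [hSdef]
  set u : Fin 3 → FourVec := fun k => ∑ i, O i k • v i with hu
  have huu : ∀ i j, mink (u i) (u j) = if i = j then -1 else 0 := by
    intro i j
    have h2 : ∀ a, mink (u i) (v a) = - O a i := by
      intro a
      rw [mink_comm, hu, mink_sum_right]
      simp [mink_smul_right, hv.orth]
    conv_lhs => rw [show u j = ∑ a, O a j • v a from rfl, mink_sum_right]
    simp only [mink_smul_right, h2]
    have := hOO i j
    rw [show (∑ a, O a j * -O a i) = - ∑ a, O a i * O a j by
      rw [← Finset.sum_neg_distrib]; exact Finset.sum_congr rfl fun a _ => by ring, this]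
    split_ifs <;> simp
  have hou : ∀ i, mink u₀ (u i) = 0 := by
    intro i
    rw [hu, mink_sum_right]
    simp [mink_smul_right, hv.orth₀]
  have heig : ∀ k, (mixed Λ).mulVec (u k) = hS.eigenvalues k • u k := by
    intro k
    simp only [hu, Matrix.mulVec_sum, Matrix.mulVec_smul, hAv, Finset.smul_sum, smul_smul]
    rw [Finset.sum_comm]
    refine Finset.sum_congr rfl fun i _ => ?_
    rw [← Finset.sum_smul, ← hSO i k]
    congr 1
    exact Finset.sum_congr rfl fun j _ => mul_comm _ _
  have hF : IsLorentzFrame u₀ u := ⟨h0, h1, hou, huu⟩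
  refine ⟨l₀, hS.eigenvalues, u₀, u, hl, fun i => ?_, ⟨hF, hA, heig⟩⟩
  -- The null vector `u₀ + uᵢ` is the test vector: the quartic form takes the value `l₀ - lᵢ` on it.
  have hm : mink (u₀ + u i) (u₀ + u i) = 0 := by
    simp [mink_add_left, mink_add_right, mink_comm (u i) u₀, hou, h1, huu]
  have hm0 : mink u₀ (u₀ + u i) = 1 := by
    simp [mink_add_right, hou, h1]
  have ht := (hF.time_pos_iff hm.ge).2 (by rw [hm0]; exact one_pos)
  have := hpos (u₀ + u i) ⟨ht.le, hm.ge⟩ (by intro h; rw [h] at ht; simp at ht)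
  rw [quartic, Matrix.mulVec_add, hA, heig] at this
  simp only [mink_add_left, mink_add_right, mink_smul_right, mink_comm (u i) u₀, hou, h1,
    huu] at this
  simp at this
  linarith

/-- A spacelike eigenvalue is one of the three spatial eigenvalues of an eigenframe. -/
theorem IsEigenframe.exists_eq {Λ : Matrix (Fin 4) (Fin 4) ℝ} (hs : Λ.IsSymm) {l₀ : ℝ}
    {l : Fin 3 → ℝ} {u₀ : FourVec} {u : Fin 3 → FourVec} (h : IsEigenframe (mixed Λ) l₀ l u₀ u)
    {a : ℝ} (ha : IsSpacelikeEigenvalue Λ a) : ∃ i, l i = a := by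
  obtain ⟨x, hx, hax⟩ := ha
  by_contra! hn
  -- Eigenvectors of a self-adjoint map for different eigenvalues are orthogonal; `x` would then lie
  -- along `u₀` and fail to be spacelike.
  have h0 : ∀ i, mink (u i) x = 0 := by
    intro i
    have h1 := mink_mixed hs (u i) x
    rw [hax, h.eig, mink_smul_left, mink_smul_right] at h1
    have h2 : (l i - a) * mink (u i) x = 0 := by linarith
    exact (mul_eq_zero.1 h2).resolve_left (sub_ne_zero.2 (hn i))
  rw [h.mink_eq_coords] at hx
  simp only [h0] at hx
  simp at hx
  nlinarith [mul_self_nonneg (mink u₀ x)]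

/-- The spatial vectors of an eigenframe may be permuted and reflected. -/
theorem IsEigenframe.reindex {A : Matrix (Fin 4) (Fin 4) ℝ} {l₀ : ℝ}
    {l : Fin 3 → ℝ} {u₀ : FourVec} {u : Fin 3 → FourVec} (h : IsEigenframe A l₀ l u₀ u)
    {π : Fin 3 → Fin 3} (hπ : Function.Injective π) (x : FourVec) :
    ∃ u', IsEigenframe A l₀ (l ∘ π) u₀ u' ∧ ∀ i, 0 ≤ -mink (u' i) x := by
  have hsg : ∀ i, ∃ s : ℝ, s * s = 1 ∧ 0 ≤ -(s * mink (u (π i)) x) := by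
    intro i
    rcases le_total (mink (u (π i)) x) 0 with h' | h'
    · exact ⟨1, by norm_num, by linarith⟩
    · exact ⟨-1, by norm_num, by linarith⟩
  choose s hs hsx using hsg
  refine ⟨fun i => s i • u (π i), ⟨⟨h.pos, h.unit, fun i => ?_, fun i j => ?_⟩, h.eig₀,
    fun i => ?_⟩, fun i => ?_⟩
  · rw [mink_smul_right, h.orth₀, mul_zero]
  · rw [mink_smul_right, mink_smul_left, h.orth]
    by_cases hij : i = j
    · subst hij
      simp [hs]
    · simp [hij, hπ.ne hij]
  · rw [Matrix.mulVec_smul, h.eig, smul_comm]; rfl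
  · rw [mink_smul_left]; exact hsx i
-- Convexity and intermediate values for sums of squared quotients.
/-- Strict convexity of `s ↦ ∑ (μᵢ / ((1 - s) xᵢ + s yᵢ))²`, also where denominators vanish. -/
theorem sum_sq_lt_one_of_between {ι : Type*} [Fintype ι] {x y μ p q w : ι → ℝ} {s : ℝ}
    (hs0 : 0 < s) (hs1 : s < 1) (hx : ∀ i, 0 ≤ x i) (hy : ∀ i, 0 ≤ y i) (hxy : ∀ i, x i ≠ y i)
    (hp : ∀ i, 0 ≤ p i) (hq : ∀ i, 0 ≤ q i) (hμ : ∀ i, 0 ≤ μ i)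
    (hpx : ∀ i, μ i = x i * p i) (hqy : ∀ i, μ i = y i * q i)
    (hw : ∀ i, μ i = ((1 - s) * x i + s * y i) * w i)
    (hp1 : ∑ i, p i ^ 2 ≤ 1) (hq1 : ∑ i, q i ^ 2 ≤ 1) : ∑ i, w i ^ 2 < 1 := by
  have he : ∀ i, 0 < (1 - s) * x i + s * y i := by
    intro i
    rcases (hx i).eq_or_lt with h | h
    · have : 0 < y i := (hy i).lt_of_ne (by rw [h]; exact hxy i)
      rw [← h]; simpa using mul_pos hs0 this
    · have := mul_nonneg hs0.le (hy i)
      have := mul_pos (sub_pos.2 hs1) h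
      linarith
  have hwn : ∀ i, 0 ≤ w i := fun i => nonneg_of_mul_nonneg_right ((hw i) ▸ hμ i) (he i)
  -- This is convexity of `x ↦ μ / x`. Without division it says that `p = μ / x` and `q = μ / y` are
  -- ordered oppositely to `x` and `y`, whence the sign of `hcross`.
  have hle : ∀ i, w i ≤ (1 - s) * p i + s * q i := by
    intro i
    have hcross : 0 ≤ (x i - y i) * (q i - p i) := by
      have h1 : x i * p i = y i * q i := (hpx i).symm.trans (hqy i)
      rcases lt_or_gt_of_ne (hxy i) with h | h
      · have : q i ≤ p i := le_of_mul_le_mul_left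
          (h1 ▸ mul_le_mul_of_nonneg_right h.le (hp i)) ((hx i).trans_lt h)
        nlinarith
      · have : p i ≤ q i := le_of_mul_le_mul_left
          (h1.symm ▸ mul_le_mul_of_nonneg_right h.le (hq i)) ((hy i).trans_lt h)
        nlinarith
    refine le_of_mul_le_mul_left ?_ (he i)
    rw [← hw i]
    have h2 : ((1 - s) * x i + s * y i) * ((1 - s) * p i + s * q i) =
        μ i + (1 - s) * s * ((x i - y i) * (q i - p i)) := by
      linear_combination -(1 - s) * hpx i - s * hqy i
    have := mul_nonneg (mul_nonneg (sub_nonneg.2 hs1.le) hs0.le) hcross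
    linarith
  have hsq : ∀ i, w i ^ 2 ≤ (1 - s) * p i ^ 2 + s * q i ^ 2 - (1 - s) * s * (p i - q i) ^ 2 := by
    intro i
    calc w i ^ 2 ≤ ((1 - s) * p i + s * q i) ^ 2 := by gcongr; exacts [hwn i, hle i]
      _ = _ := by ring
  -- Strictness comes from the term `(p j - q j)²` at an index with `μ j ≠ 0`; if there is none, all
  -- `w i` vanish.
  by_cases hz : ∀ i, μ i = 0
  · have : ∀ i, w i = 0 := fun i =>
      (mul_eq_zero.1 ((hw i).symm.trans (hz i))).resolve_left (he i).ne'
    simp [this]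
  · push Not at hz
    obtain ⟨j, hj⟩ := hz
    have hpq : p j ≠ q j := by
      intro h
      have h1 : (x j - y j) * p j = 0 := by
        have := (hpx j).symm.trans (hqy j)
        rw [← h] at this; linarith
      rcases mul_eq_zero.1 h1 with h2 | h2
      · exact hxy j (sub_eq_zero.1 h2)
      · exact hj (by rw [hpx, h2, mul_zero])
    have hpos : 0 < (1 - s) * s * (p j - q j) ^ 2 := by
      have := sub_pos.2 hs1
      have := sub_ne_zero.2 hpq
      positivity
    calc ∑ i, w i ^ 2 < ∑ i, ((1 - s) * p i ^ 2 + s * q i ^ 2) := by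
          refine Finset.sum_lt_sum (fun i _ => ?_) ⟨j, Finset.mem_univ j, ?_⟩
          · have := hsq i
            have : 0 ≤ (1 - s) * s * (p i - q i) ^ 2 := by
              have := sub_pos.2 hs1
              positivity
            linarith
          · linarith [hsq j]
      _ = (1 - s) * ∑ i, p i ^ 2 + s * ∑ i, q i ^ 2 := by
          rw [Finset.sum_add_distrib, Finset.mul_sum, Finset.mul_sum]
      _ ≤ (1 - s) * 1 + s * 1 := by
          have := sub_pos.2 hs1
          gcongr
      _ = 1 := by ring

/-- An intermediate value theorem for `s ↦ ∑ (μᵢ / ((1 - s) xᵢ + s yᵢ))²`, where at `s = 1`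
denominators may vanish together with numerators. -/
theorem exists_sum_sq_eq_one {ι : Type*} [Fintype ι] {x y μ : ι → ℝ}
    (hx : ∀ i, 0 < x i) (hy : ∀ i, 0 ≤ y i) (hμ : ∀ i, 0 ≤ μ i)
    (h0 : ∑ i, (μ i / x i) ^ 2 < 1) (h1 : (∃ j, y j = 0) ∨ 1 ≤ ∑ i, (μ i / y i) ^ 2) :
    ∃ (s : ℝ) (p : ι → ℝ), 0 < s ∧ s ≤ 1 ∧ (∀ i, 0 ≤ p i) ∧ (∀ i, μ i = ((1 - s) * x i + s * y i) * p i) ∧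
      ∑ i, p i ^ 2 = 1 := by
  classical
  -- The division-free equations keep this set closed even where denominators vanish. The solution
  -- is sought at the largest `s` in it.
  set K : Set (ℝ × (ι → ℝ)) := {z |
    z ∈ Set.Icc (0 : ℝ) 1 ×ˢ Set.univ.pi (fun _ : ι => Set.Icc (0 : ℝ) 1) ∧
    (∀ i, μ i = ((1 - z.1) * x i + z.1 * y i) * z.2 i) ∧ ∑ i, z.2 i ^ 2 ≤ 1} with hK
  have hKc : IsCompact K := by
    refine (isCompact_Icc.prod (isCompact_univ_pi fun _ => isCompact_Icc)).inter_right ?_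
    refine IsClosed.inter ?_ ?_
    · have : IsClosed (⋂ i, {z : ℝ × (ι → ℝ) | μ i = ((1 - z.1) * x i + z.1 * y i) * z.2 i}) :=
        isClosed_iInter fun i => isClosed_eq continuous_const (by fun_prop)
      rwa [← Set.ofPred_forall] at this
    · have : Continuous fun z : ℝ × (ι → ℝ) => ∑ i, z.2 i ^ 2 := by fun_prop
      exact isClosed_le this continuous_const
  have hmem : ∀ s p, 0 ≤ s → s ≤ 1 → (∀ i, 0 ≤ p i) →
      (∀ i, μ i = ((1 - s) * x i + s * y i) * p i) → ∑ i, p i ^ 2 ≤ 1 → (s, p) ∈ K := by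
    intro s p hs0 hs1 hp hμp hp1
    refine ⟨⟨⟨hs0, hs1⟩, fun i _ => ⟨hp i, ?_⟩⟩, hμp, hp1⟩
    have := Finset.single_le_sum (f := fun i => p i ^ 2) (fun i _ => sq_nonneg _)
      (Finset.mem_univ i)
    exact (sq_le_one_iff₀ (hp i)).1 (this.trans hp1)
  have hpos : ∀ s, 0 ≤ s → s < 1 → ∀ i, 0 < (1 - s) * x i + s * y i := by
    intro s hs0 hs1 i
    have := mul_pos (sub_pos.2 hs1) (hx i)
    have := mul_nonneg hs0 (hy i)
    linarith
  have hK0 : (0, fun i => μ i / x i) ∈ K := by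
    refine hmem _ _ le_rfl zero_le_one (fun i => div_nonneg (hμ i) (hx i).le) (fun i => ?_) h0.le
    have := (hx i).ne'
    field_simp
    ring
  obtain ⟨⟨s, p⟩, hz, hmax⟩ := hKc.exists_isMaxOn ⟨_, hK0⟩ (f := Prod.fst) continuous_fst.continuousOn
  obtain ⟨⟨⟨hs0, hs1⟩, hp⟩, hμp, hp1⟩ := hz
  dsimp only at hs0 hs1 hp hμp hp1
  have hp0 : ∀ i, 0 ≤ p i := fun i => (hp i trivial).1
  -- Below `s = 1` the denominators are positive, so by continuity a strict inequality survives for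
  -- slightly larger `s`; a maximal `s < 1` must give equality.
  have step : ∀ s, 0 ≤ s → s < 1 → ∑ i, (μ i / ((1 - s) * x i + s * y i)) ^ 2 < 1 →
      ∃ s', s < s' ∧ ∃ p', (s', p') ∈ K := by
    intro s hs0 hs1 hlt
    have hc : ContinuousAt (fun r : ℝ => ∑ i, (μ i / ((1 - r) * x i + r * y i)) ^ 2) s := by
      refine tendsto_finsetSum _ fun i _ => ?_
      have : ContinuousAt (fun r : ℝ => (1 - r) * x i + r * y i) s := by fun_prop
      exact (continuousAt_const.div this (hpos s hs0 hs1 i).ne').pow 2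
    have e1 := (hc.eventually (gt_mem_nhds hlt)).filter_mono (nhdsWithin_le_nhds (s := Set.Ioi s))
    have e2 : ∀ᶠ r in nhdsWithin s (Set.Ioi s), r ∈ Set.Ioo s 1 := Ioo_mem_nhdsGT hs1
    obtain ⟨r, hr1, hr2⟩ := (e1.and e2).exists
    have hr0 := hs0.trans hr2.1.le
    refine ⟨r, hr2.1, fun i => μ i / ((1 - r) * x i + r * y i), hmem _ _ hr0 hr2.2.le
      (fun i => div_nonneg (hμ i) (hpos r hr0 hr2.2 i).le) (fun i => ?_) hr1.le⟩
    rw [mul_div_cancel₀ _ (hpos r hr0 hr2.2 i).ne']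
  have hs : 0 < s := by
    obtain ⟨s', h1, p', h2⟩ := step 0 le_rfl one_pos (by simpa using h0)
    exact h1.trans_le (hmax h2)
  rcases hp1.eq_or_lt with he | hlt
  · exact ⟨s, p, hs, hs1, hp0, hμp, he⟩
  rcases hs1.eq_or_lt with rfl | hs1'
  · by_cases hj : ∃ j, y j = 0
    · obtain ⟨j, hj⟩ := hj
      -- At `s = 1` the equation for `j` reads `μ j = 0 * p j`, so `p j` is free and can absorb the
      -- missing length.
      refine ⟨1, Function.update p j (Real.sqrt (p j ^ 2 + (1 - ∑ i, p i ^ 2))), one_pos, le_rfl,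
        fun i => ?_, fun i => ?_, ?_⟩
      · by_cases h : i = j
        · subst h; simp
        · simpa [h] using hp0 i
      · by_cases h : i = j
        · subst h
          have := hμp i
          simp only [hj] at this ⊢
          simpa [hj] using this
        · simpa [h] using hμp i
      · have e : ∀ f : ι → ℝ, ∑ i, f i ^ 2 = f j ^ 2 + ∑ i ∈ Finset.univ.erase j, f i ^ 2 :=
          fun f => (Finset.add_sum_erase _ (fun i => f i ^ 2) (Finset.mem_univ j)).symm
        rw [e, Function.update_self, Real.sq_sqrt (by nlinarith [sq_nonneg (p j)])]
        have : ∑ i ∈ Finset.univ.erase j, (Function.update p j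
            (Real.sqrt (p j ^ 2 + (1 - ∑ i, p i ^ 2))) i) ^ 2 =
            ∑ i ∈ Finset.univ.erase j, p i ^ 2 := by
          refine Finset.sum_congr rfl fun i hi => ?_
          rw [Function.update_of_ne (Finset.ne_of_mem_erase hi)]
        rw [this]
        have := e p
        linarith
    · have h2 := h1.resolve_left hj
      push Not at hj
      have : ∀ i, μ i / y i = p i := by
        intro i
        rw [hμp i, div_eq_iff (hj i)]
        ring
      simp only [this] at h2
      linarith
  · exfalso
    have : ∀ i, μ i / ((1 - s) * x i + s * y i) = p i := by
      intro i
      rw [div_eq_iff (hpos s hs0 hs1' i).ne', hμp i, mul_comm]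
    obtain ⟨s', h1, p', h2⟩ := step s hs0 hs1' (by simpa only [this] using hlt)
    exact absurd (hmax h2) (not_le.2 h1)

/-! ### The normalized equation and its branches. -/

/-- The pairs `(t, n)`, `n` a unit vector, with `mᵢ = (1 - dᵢ t) nᵢ`. -/
def normalSolutions (d m : Fin 3 → ℝ) : Set (ℝ × (Fin 3 → ℝ)) :=
  {x | ∑ i, x.2 i ^ 2 = 1 ∧ ∀ i, m i = (1 - d i * x.1) * x.2 i}

/-- The solutions for which `1 - dᵢ t` and `nᵢ` have the weak signs `εᵢ`. -/
def solutionBranch (d m ε : Fin 3 → ℝ) : Set (ℝ × (Fin 3 → ℝ)) :=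
  {x | x ∈ normalSolutions d m ∧ ∀ i, 0 ≤ ε i * x.2 i ∧ 0 ≤ ε i * (1 - d i * x.1)}

/-- The vector with `mᵢ = (1 - dᵢ t) nᵢ` exists and is shorter than a unit vector. -/
def IsShortAt (d m : Fin 3 → ℝ) (t : ℝ) : Prop :=
  (∀ i, 1 - d i * t ≠ 0) ∧ ∑ i, (m i / (1 - d i * t)) ^ 2 < 1

section
variable {d m ε : Fin 3 → ℝ}

theorem sum_sq_sign_mul (hε : ∀ i, ε i * ε i = 1) (n : Fin 3 → ℝ) :
    ∑ i, (ε i * n i) ^ 2 = ∑ i, n i ^ 2 :=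
  Finset.sum_congr rfl fun i _ => by rw [mul_pow, sq (ε i), hε, one_mul]

/-- Between two weak solutions of the same sign pattern there is no solution. -/
theorem not_between (hd : ∀ i, 0 < d i) (hm : ∀ i, 0 ≤ m i) (hε : ∀ i, ε i * ε i = 1)
    {t₁ t₂ t₃ : ℝ} {n₁ n₂ n₃ : Fin 3 → ℝ} (h12 : t₁ < t₂) (h23 : t₂ < t₃)
    (h1 : ∑ i, n₁ i ^ 2 ≤ 1) (hm1 : ∀ i, m i = (1 - d i * t₁) * n₁ i)
    (hs1 : ∀ i, 0 ≤ ε i * n₁ i ∧ 0 ≤ ε i * (1 - d i * t₁))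
    (h2 : 1 ≤ ∑ i, n₂ i ^ 2) (hm2 : ∀ i, m i = (1 - d i * t₂) * n₂ i)
    (h3 : ∑ i, n₃ i ^ 2 ≤ 1) (hm3 : ∀ i, m i = (1 - d i * t₃) * n₃ i)
    (hs3 : ∀ i, 0 ≤ ε i * n₃ i ∧ 0 ≤ ε i * (1 - d i * t₃)) : False := by
  have h13 : 0 < t₃ - t₁ := by linarith
  have hsq : ∀ i, ε i ^ 2 = 1 := fun i => by rw [sq, hε]
  have := sum_sq_lt_one_of_between (x := fun i => ε i * (1 - d i * t₁))
    (y := fun i => ε i * (1 - d i * t₃)) (μ := m) (p := fun i => ε i * n₁ i)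
    (q := fun i => ε i * n₃ i) (w := fun i => ε i * n₂ i) (s := (t₂ - t₁) / (t₃ - t₁))
    (div_pos (by linarith) h13) ((div_lt_one h13).2 (by linarith)) (fun i => (hs1 i).2)
    (fun i => (hs3 i).2) (fun i h => ?_) (fun i => (hs1 i).1) (fun i => (hs3 i).1) hm
    (fun i => ?_) (fun i => ?_) (fun i => ?_) (by rwa [sum_sq_sign_mul hε])
    (by rwa [sum_sq_sign_mul hε])
  · rw [sum_sq_sign_mul hε] at this
    linarith
  · have h4 := congrArg (fun z => ε i * z) h
    simp only [← mul_assoc, hε, one_mul] at h4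
    have : d i * (t₃ - t₁) = 0 := by linarith
    rcases mul_eq_zero.1 this with h | h
    · exact (hd i).ne' h
    · exact h13.ne' h
  · rw [hm1 i]; linear_combination -(1 - d i * t₁) * n₁ i * hsq i
  · rw [hm3 i]; linear_combination -(1 - d i * t₃) * n₃ i * hsq i
  · have e : (1 - (t₂ - t₁) / (t₃ - t₁)) * (ε i * (1 - d i * t₁)) +
        (t₂ - t₁) / (t₃ - t₁) * (ε i * (1 - d i * t₃)) = ε i * (1 - d i * t₂) := by
      field_simp
      ring
    rw [e, hm2 i]
    linear_combination -(1 - d i * t₂) * n₂ i * hsq i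

theorem sign_mul_div_nonneg {e a b : ℝ} (ha : 0 ≤ a) (h : 0 ≤ e * b) : 0 ≤ e * (a / b) := by
  rcases eq_or_ne b 0 with rfl | hb
  · simp
  · have : e * (a / b) = (e * b) * (a / b ^ 2) := by field_simp
    rw [this]; positivity

theorem eventually_isShortAt_atTop (hd : ∀ i, 0 < d i) (m : Fin 3 → ℝ) :
    ∀ᶠ t in Filter.atTop, IsShortAt d m t := by
  have h1 : ∀ i, Filter.Tendsto (fun t => 1 - d i * t) Filter.atTop Filter.atBot := fun i =>
    Filter.tendsto_atBot_add_const_left _ 1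
      (Filter.tendsto_neg_atTop_atBot.comp (Filter.Tendsto.const_mul_atTop (hd i) Filter.tendsto_id))
  have h2 : Filter.Tendsto (fun t => ∑ i, (m i / (1 - d i * t)) ^ 2) Filter.atTop (nhds 0) := by
    have := tendsto_finsetSum (Finset.univ : Finset (Fin 3)) (fun i _ =>
      ((Filter.Tendsto.const_div_atBot (h1 i) (m i)).pow 2))
    simpa using this
  filter_upwards [h2.eventually (gt_mem_nhds one_pos),
    Filter.eventually_all.2 fun i => (h1 i).eventually_lt_atBot 0] with t ht1 ht2
  exact ⟨fun i => (ht2 i).ne, ht1⟩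

theorem eventually_isShortAt_atBot (hd : ∀ i, 0 < d i) (m : Fin 3 → ℝ) :
    ∀ᶠ t in Filter.atBot, IsShortAt d m t := by
  have h1 : ∀ i, Filter.Tendsto (fun t => 1 - d i * t) Filter.atBot Filter.atTop := fun i =>
    Filter.tendsto_atTop_add_const_left _ 1
      (Filter.tendsto_neg_atBot_atTop.comp (Filter.Tendsto.const_mul_atBot (hd i) Filter.tendsto_id))
  have h2 : Filter.Tendsto (fun t => ∑ i, (m i / (1 - d i * t)) ^ 2) Filter.atBot (nhds 0) := by
    have := tendsto_finsetSum (Finset.univ : Finset (Fin 3)) (fun i _ =>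
      ((Filter.Tendsto.const_div_atTop (h1 i) (m i)).pow 2))
    simpa using this
  filter_upwards [h2.eventually (gt_mem_nhds one_pos),
    Filter.eventually_all.2 fun i => (h1 i).eventually_gt_atTop 0] with t ht1 ht2
  exact ⟨fun i => (ht2 i).ne', ht1⟩

/-- Starting at a short vector and moving until some `1 - dᵢ t` vanishes, or until the vector
has become long, one meets a solution. -/
theorem exists_mem_solutionBranch (hm : ∀ i, 0 ≤ m i) (hε : ∀ i, ε i * ε i = 1) {t₀ T : ℝ}
    (h0 : IsShortAt d m t₀) (hs0 : ∀ i, 0 ≤ ε i * (1 - d i * t₀))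
    (hsT : ∀ i, 0 ≤ ε i * (1 - d i * T))
    (hT : (∃ j, 1 - d j * T = 0) ∨ 1 ≤ ∑ i, (m i / (1 - d i * T)) ^ 2) :
    ∃ s, 0 < s ∧ s ≤ 1 ∧ ∃ n, (t₀ + s * (T - t₀), n) ∈ solutionBranch d m ε := by
  have hsq : ∀ i, ε i ^ 2 = 1 := fun i => by rw [sq, hε]
  have hne : ∀ i, ε i ≠ 0 := fun i h => by have := hε i; simp [h] at this
  have hdiv : ∀ t i, m i / (ε i * (1 - d i * t)) = ε i * (m i / (1 - d i * t)) := by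
    intro t i
    rw [mul_comm (ε i), ← div_div, div_eq_iff (hne i)]
    linear_combination -(m i / (1 - d i * t)) * hε i
  obtain ⟨s, p, hs, hs1, hp, hμ, hp1⟩ := exists_sum_sq_eq_one
    (x := fun i => ε i * (1 - d i * t₀)) (y := fun i => ε i * (1 - d i * T)) (μ := m)
    (fun i => (hs0 i).lt_of_ne (mul_ne_zero (hne i) (h0.1 i)).symm) hsT hm
    (by simp only [hdiv]; rw [sum_sq_sign_mul hε]; exact h0.2)
    (by
      simp only [hdiv]
      rw [sum_sq_sign_mul hε]
      exact hT.imp_left fun ⟨j, hj⟩ => ⟨j, by rw [hj, mul_zero]⟩)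
  refine ⟨s, hs, hs1, fun i => ε i * p i, ⟨?_, fun i => ?_⟩, fun i => ⟨?_, ?_⟩⟩
  · dsimp only
    rw [sum_sq_sign_mul hε, hp1]
  · dsimp only
    rw [hμ i]; ring
  · dsimp only
    rw [← mul_assoc, hε, one_mul]; exact hp i
  · have := hs0 i
    have := hsT i
    have : ε i * (1 - d i * (t₀ + s * (T - t₀))) =
      (1 - s) * (ε i * (1 - d i * t₀)) + s * (ε i * (1 - d i * T)) := by ring
    dsimp only
    rw [this]
    have := sub_nonneg.2 hs1
    positivity

theorem encard_le_one_of_fst {α : Type*} {S : Set (ℝ × α)}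
    (hinj : ∀ x ∈ S, ∀ y ∈ S, x.1 = y.1 → x = y) (h : ∀ x ∈ S, ∀ y ∈ S, ¬ x.1 < y.1) :
    S.encard ≤ 1 :=
  Set.encard_le_one_iff.2 fun x y hx hy =>
    hinj x hx y hy (le_antisymm (not_lt.1 (h y hy x hx)) (not_lt.1 (h x hx y hy)))

theorem encard_le_two_of_fst {α : Type*} {S : Set (ℝ × α)}
    (hinj : ∀ x ∈ S, ∀ y ∈ S, x.1 = y.1 → x = y)
    (h : ∀ x ∈ S, ∀ y ∈ S, ∀ z ∈ S, x.1 < y.1 → ¬ y.1 < z.1) : S.encard ≤ 2 := by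
  by_contra! hc
  obtain ⟨x, y, z, hxyz, hxy, hxz, hyz⟩ : ∃ x y z, ({x, y, z} : Set (ℝ × α)) ⊆ S ∧ x ≠ y ∧
      x ≠ z ∧ y ≠ z := by
    obtain ⟨t, ht, hc3⟩ := Set.exists_subset_encard_eq (Order.add_one_le_of_lt hc)
    obtain ⟨x, y, z, h1, h2, h3, rfl⟩ := Set.encard_eq_three.1 hc3
    exact ⟨x, y, z, ht, h1, h2, h3⟩
  have hx : x ∈ S := hxyz (by simp)
  have hy : y ∈ S := hxyz (by simp)
  have hz : z ∈ S := hxyz (by simp)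
  have h1 : x.1 ≠ y.1 := fun e => hxy (hinj x hx y hy e)
  have h2 : x.1 ≠ z.1 := fun e => hxz (hinj x hx z hz e)
  have h3 : y.1 ≠ z.1 := fun e => hyz (hinj y hy z hz e)
  rcases lt_or_gt_of_ne h1 with a | a <;> rcases lt_or_gt_of_ne h2 with b | b <;>
    rcases lt_or_gt_of_ne h3 with c | c
  · exact h x hx y hy z hz a c
  · exact h x hx z hz y hy b c
  · exact absurd (a.trans c) b.not_gt
  · exact h z hz x hx y hy b a
  · exact h y hy x hx z hz a b
  · exact absurd (b.trans c) a.not_gt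
  · exact h y hy z hz x hx c b
  · exact h z hz y hy x hx c a

/-- As the `dᵢ` are distinct, at most one `1 - dᵢ t` vanishes. All other components of `n` are fixed
by the equation, the remaining one by the norm and its prescribed sign. -/
theorem solutionBranch_inj (hdi : Function.Injective d) (hε : ∀ i, ε i * ε i = 1) :
    ∀ x ∈ solutionBranch d m ε, ∀ y ∈ solutionBranch d m ε, x.1 = y.1 → x = y := by
  rintro ⟨t, n⟩ ⟨⟨hn1, hn⟩, hnε⟩ ⟨t', n'⟩ ⟨⟨hn1', hn'⟩, hnε'⟩ (rfl : t = t')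
  dsimp only at *
  have h1 : ∀ i, 1 - d i * t ≠ 0 → n i = n' i := fun i hi =>
    mul_left_cancel₀ hi ((hn i).symm.trans (hn' i))
  suffices n = n' by rw [this]
  funext j
  by_cases hj : 1 - d j * t = 0
  · have h2 : ∀ i ∈ Finset.univ.erase j, n i ^ 2 = n' i ^ 2 := by
      intro i hi
      rw [h1 i fun h => ?_]
      have h3 : (d i - d j) * t = 0 := by linarith
      rcases mul_eq_zero.1 h3 with h4 | h4
      · exact Finset.ne_of_mem_erase hi (hdi (sub_eq_zero.1 h4))
      · rw [h4] at hj; simp at hj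
    rw [← Finset.add_sum_erase _ _ (Finset.mem_univ j)] at hn1 hn1'
    rw [Finset.sum_congr rfl h2] at hn1
    have h5 : (ε j * n j) ^ 2 = (ε j * n' j) ^ 2 := by
      rw [mul_pow, mul_pow]; congr 1; linarith
    have h6 := (pow_left_inj₀ (hnε j).1 (hnε' j).1 two_ne_zero).1 h5
    have h7 := congrArg (fun z => ε j * z) h6
    simpa only [← mul_assoc, hε, one_mul] using h7
  · exact h1 j hj

/-- Of three solutions on one branch, convexity would make the middle one shorter than a unit
vector. -/
theorem solutionBranch_encard_le (hd : ∀ i, 0 < d i) (hdi : Function.Injective d)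
    (hm : ∀ i, 0 ≤ m i) (hε : ∀ i, ε i * ε i = 1) : (solutionBranch d m ε).encard ≤ 2 :=
  encard_le_two_of_fst (solutionBranch_inj hdi hε) fun _ hx _ hy _ hz h1 h2 =>
    not_between hd hm hε h1 h2 hx.1.1.le hx.1.2 hx.2 hy.1.1.ge hy.1.2 hz.1.1.le hz.1.2 hz.2

theorem IsShortAt.weak (hm : ∀ i, 0 ≤ m i) {t : ℝ} (h : IsShortAt d m t)
    (hs : ∀ i, 0 ≤ ε i * (1 - d i * t)) :
    ∑ i, (m i / (1 - d i * t)) ^ 2 ≤ 1 ∧ (∀ i, m i = (1 - d i * t) * (m i / (1 - d i * t))) ∧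
      ∀ i, 0 ≤ ε i * (m i / (1 - d i * t)) ∧ 0 ≤ ε i * (1 - d i * t) :=
  ⟨h.2.le, fun i => (mul_div_cancel₀ _ (h.1 i)).symm,
    fun i => ⟨sign_mul_div_nonneg (hm i) (hs i), hs i⟩⟩

/-- A branch between two zeros of the `1 - dᵢ t` with a short vector in between. -/
theorem solutionBranch_encard_eq_two (hd : ∀ i, 0 < d i) (hdi : Function.Injective d)
    (hm : ∀ i, 0 ≤ m i) (hε : ∀ i, ε i * ε i = 1) {t₀ T T' : ℝ} (h0 : IsShortAt d m t₀)
    (hs0 : ∀ i, 0 ≤ ε i * (1 - d i * t₀)) (hT : t₀ ≤ T) (hsT : ∀ i, 0 ≤ ε i * (1 - d i * T))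
    (hzT : ∃ j, 1 - d j * T = 0) (hT' : T' ≤ t₀) (hsT' : ∀ i, 0 ≤ ε i * (1 - d i * T'))
    (hzT' : ∃ j, 1 - d j * T' = 0) : (solutionBranch d m ε).encard = 2 := by
  refine le_antisymm (solutionBranch_encard_le hd hdi hm hε) ?_
  -- One solution lies on each side of `t₀`, before or at the pole bounding the branch.
  obtain ⟨s, hs, -, n, hn⟩ := exists_mem_solutionBranch hm hε h0 hs0 hsT (Or.inl hzT)
  obtain ⟨s', hs', -, n', hn'⟩ := exists_mem_solutionBranch hm hε h0 hs0 hsT' (Or.inl hzT')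
  have hTlt : t₀ < T := hT.lt_of_ne fun h => by
    obtain ⟨j, hj⟩ := hzT; rw [← h] at hj; exact h0.1 j hj
  have hne : (t₀ + s * (T - t₀), n) ≠ (t₀ + s' * (T' - t₀), n') := by
    intro h
    have h1 := congrArg Prod.fst h
    dsimp only at h1
    have h2 := mul_pos hs (sub_pos.2 hTlt)
    have h3 := mul_nonneg hs'.le (sub_nonneg.2 hT')
    linarith
  rw [← Set.encard_pair hne]
  exact Set.encard_le_encard (Set.pair_subset hn hn')

end
-- Existence and uniqueness on the outer branches, and perturbation off the poles.
section
variable {d m : Fin 3 → ℝ}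

theorem exists_forall_le_div (hd : ∀ i, 0 < d i) :
    ∃ T, 0 < T ∧ (∀ i, 0 ≤ 1 - d i * T) ∧ ∃ j, 1 - d j * T = 0 := by
  obtain ⟨j, hj⟩ := Finite.exists_max d
  refine ⟨1 / d j, one_div_pos.2 (hd j), fun i => ?_, j, ?_⟩
  · rw [mul_one_div, sub_nonneg, div_le_one (hd j)]
    exact hj i
  · rw [mul_one_div_cancel (hd j).ne', sub_self]

theorem exists_forall_div_le (hd : ∀ i, 0 < d i) :
    ∃ T, (∀ i, 1 - d i * T ≤ 0) ∧ ∃ j, 1 - d j * T = 0 := by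
  obtain ⟨j, hj⟩ := Finite.exists_min d
  refine ⟨1 / d j, fun i => ?_, j, ?_⟩
  · rw [mul_one_div, sub_nonpos, one_le_div (hd j)]
    exact hj i
  · rw [mul_one_div_cancel (hd j).ne', sub_self]

theorem isShortAt_zero (h : ∑ i, m i ^ 2 < 1) : IsShortAt d m 0 :=
  ⟨fun i => by simp, by simpa using h⟩

theorem exists_isShortAt_neg (hd : ∀ i, 0 < d i) (m : Fin 3 → ℝ) :
    ∀ a ≤ (0 : ℝ), ∃ t < a, IsShortAt d m t ∧ ∀ i, 0 ≤ 1 - d i * t := by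
  intro a ha
  obtain ⟨t, h1, h2⟩ := ((Filter.eventually_lt_atBot a).and
    (eventually_isShortAt_atBot hd m)).exists
  refine ⟨t, h1, h2, fun i => ?_⟩
  nlinarith [hd i]

theorem exists_isShortAt_pos (hd : ∀ i, 0 < d i) (m : Fin 3 → ℝ) (a : ℝ) :
    ∃ t > a, IsShortAt d m t ∧ ∀ i, 1 - d i * t ≤ 0 := by
  have h1 : ∀ i, ∀ᶠ t in Filter.atTop, 1 - d i * t ≤ 0 := fun i => by
    filter_upwards [Filter.eventually_ge_atTop (1 / d i)] with t ht
    rw [div_le_iff₀ (hd i)] at ht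
    linarith
  obtain ⟨t, h1, h2, h3⟩ := ((Filter.eventually_gt_atTop a).and
    ((eventually_isShortAt_atTop hd m).and (Filter.eventually_all.2 h1))).exists
  exact ⟨t, h1, h2, h3⟩

/-- At `t = 0` the vector is `m` itself, which is short; moving right up to the first pole produces
a solution. -/
theorem exists_pos_mem_branch_one (hd : ∀ i, 0 < d i) (hm : ∀ i, 0 ≤ m i)
    (h : ∑ i, m i ^ 2 < 1) : ∃ x ∈ solutionBranch d m (fun _ => 1), 0 < x.1 := by
  obtain ⟨T, hT, h1, h2⟩ := exists_forall_le_div hd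
  obtain ⟨s, hs, -, n, hn⟩ := exists_mem_solutionBranch (ε := fun _ => 1) (T := T) hm (by simp)
    (isShortAt_zero h) (by simp) (by simpa using h1) (Or.inl h2)
  refine ⟨_, hn, ?_⟩
  dsimp only
  rw [zero_add, sub_zero]
  positivity

theorem exists_mem_branch_neg_one (hd : ∀ i, 0 < d i) (hm : ∀ i, 0 ≤ m i) :
    ∃ x, x ∈ solutionBranch d m (fun _ => -1) := by
  obtain ⟨t, -, h3, h4⟩ := exists_isShortAt_pos hd m 0
  obtain ⟨T, h1, h2⟩ := exists_forall_div_le hd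
  obtain ⟨s, -, -, n, hn⟩ := exists_mem_solutionBranch (ε := fun _ => -1) (T := T) hm (by simp)
    h3 (by simpa using h4) (by simpa using h1) (Or.inl h2)
  exact ⟨_, hn⟩

theorem pos_of_mem_branch {ε : Fin 3 → ℝ} (hd : ∀ i, 0 < d i) {x : ℝ × (Fin 3 → ℝ)}
    (hx : x ∈ solutionBranch d m ε) {i : Fin 3} (hi : ε i = -1) : 0 < x.1 := by
  have := (hx.2 i).2
  rw [hi] at this
  by_contra hn
  nlinarith [hd i]

theorem exists_neg_mem_normalSolutions (hd : ∀ i, 0 < d i) (hm : ∀ i, 0 ≤ m i)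
    (h : 1 < ∑ i, m i ^ 2) : ∃ x ∈ normalSolutions d m, x.1 < 0 := by
  obtain ⟨t, ht, h1, h2⟩ := exists_isShortAt_neg hd m 0 le_rfl
  obtain ⟨s, hs, hs1, n, hn⟩ := exists_mem_solutionBranch (ε := fun _ => 1) (T := 0) hm (by simp)
    h1 (by simpa using h2) (by simp) (Or.inr (by simpa using h.le))
  refine ⟨_, hn.1, ?_⟩
  -- `s = 1` means `t = 0`, where `n = m` is too long to be a unit vector.
  rcases hs1.eq_or_lt with rfl | hs1
  · have h3 := hn.1.2
    have h4 := hn.1.1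
    simp only [one_mul, zero_sub, add_neg_cancel, mul_zero, sub_zero] at h3 h4
    simp only [← h3] at h4
    linarith
  · dsimp only
    nlinarith

/-- Far to the left the vector is short. Of two negative solutions, the left one would lie between
such a point and the right one, against convexity. -/
theorem neg_encard_le_one (hd : ∀ i, 0 < d i) (hm : ∀ i, 0 ≤ m i) :
    {x ∈ normalSolutions d m | x.1 < 0}.encard ≤ 1 := by
  have hD : ∀ t < 0, ∀ i, 0 < 1 - d i * t := fun t ht i => by nlinarith [hd i]
  refine encard_le_one_of_fst ?_ ?_
  · rintro ⟨t, n⟩ ⟨⟨-, hn⟩, ht⟩ ⟨t', n'⟩ ⟨⟨-, hn'⟩, -⟩ (rfl : t = t')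
    congr 1
    funext i
    exact mul_left_cancel₀ (hD t ht i).ne' ((hn i).symm.trans (hn' i))
  · rintro ⟨t, n⟩ ⟨⟨h1, hn⟩, ht⟩ ⟨t', n'⟩ ⟨⟨h1', hn'⟩, ht'⟩ htt
    dsimp only at *
    obtain ⟨t₀, ht₀, h2, h3⟩ := exists_isShortAt_neg hd m t ht.le
    have h4 := h2.weak (ε := fun _ => 1) hm (by simpa using h3)
    refine not_between hd hm (ε := fun _ => 1) (by simp) ht₀ htt h4.1 h4.2.1 h4.2.2 h1.ge hn
      h1'.le hn' fun i => ⟨?_, by simpa using (hD t' ht' i).le⟩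
    rw [one_mul]
    exact nonneg_of_mul_nonneg_right (hn' i ▸ hm i) (hD t' ht' i)

/-- A weak solution with a vector shorter than a unit vector can be moved to a parameter where no
`1 - dᵢ t` vanishes. -/
theorem exists_isShortAt_of_shrunk {ε : Fin 3 → ℝ} {t t₁ : ℝ}
    {q : Fin 3 → ℝ} (hq : ∑ i, q i ^ 2 < 1) (hmq : ∀ i, m i = (1 - d i * t) * q i)
    (ht : ∀ i, 0 ≤ ε i * (1 - d i * t)) (ht₁ : ∀ i, 0 < ε i * (1 - d i * t₁)) :
    ∃ s, IsShortAt d m s ∧ ∀ i, 0 < ε i * (1 - d i * s) := by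
  have hc : ContinuousAt (fun θ : ℝ => ∑ i, (m i / (1 - d i * (t + θ * (t₁ - t)))) ^ 2) 0 := by
    refine tendsto_finsetSum _ fun i _ => ?_
    -- At a zero of the denominator `m i = 0`, so this summand is identically zero and continuous
    -- there (also with `0 / 0 = 0`).
    by_cases hi : 1 - d i * t = 0
    · have : m i = 0 := by rw [hmq, hi, zero_mul]
      simp [this]
    · have : ContinuousAt (fun θ : ℝ => 1 - d i * (t + θ * (t₁ - t))) 0 := by fun_prop
      exact (continuousAt_const.div this (by simpa using hi)).pow 2
  have h0 : ∑ i, (m i / (1 - d i * (t + 0 * (t₁ - t)))) ^ 2 < 1 := by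
    refine lt_of_le_of_lt (Finset.sum_le_sum fun i _ => ?_) hq
    rw [zero_mul, add_zero]
    by_cases hi : 1 - d i * t = 0
    · rw [hi]; simp [sq_nonneg]
    · rw [hmq i, mul_div_cancel_left₀ _ hi]
  have e1 := (hc.eventually (gt_mem_nhds h0)).filter_mono (nhdsWithin_le_nhds (s := Set.Ioi 0))
  have e2 : ∀ᶠ r in nhdsWithin (0 : ℝ) (Set.Ioi 0), r ∈ Set.Ioo 0 1 := Ioo_mem_nhdsGT one_pos
  obtain ⟨θ, h1, h2, h3⟩ := (e1.and e2).exists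
  have hpos : ∀ i, 0 < ε i * (1 - d i * (t + θ * (t₁ - t))) := by
    intro i
    have e : ε i * (1 - d i * (t + θ * (t₁ - t))) =
        (1 - θ) * (ε i * (1 - d i * t)) + θ * (ε i * (1 - d i * t₁)) := by ring
    rw [e]
    have := mul_nonneg (sub_nonneg.2 h3.le) (ht i)
    have := mul_pos h2 (ht₁ i)
    linarith
  refine ⟨_, ⟨fun i h => ?_, h1⟩, hpos⟩
  have := hpos i
  rw [h, mul_zero] at this
  exact lt_irrefl _ this

/-- Solutions do not depend on the signs of the `mᵢ`, up to reflections. -/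
theorem exists_normalSolution_of_abs {t : ℝ} {n : Fin 3 → ℝ}
    (h : (t, n) ∈ normalSolutions d (fun i => |m i|)) : ∃ n', (t, n') ∈ normalSolutions d m := by
  refine ⟨fun i => if m i < 0 then -n i else n i, ?_, fun i => ?_⟩
  · rw [← h.1]
    refine Finset.sum_congr rfl fun i _ => ?_
    dsimp only
    split_ifs <;> ring
  · have := h.2 i
    dsimp only at *
    split_ifs with hi
    · rw [abs_of_neg hi] at this
      linarith
    · rwa [abs_of_nonneg (not_lt.1 hi)] at this

/-! ### Sign patterns and disjointness of branches. -/

/-- The sign pattern of `1 - dᵢ t` when `t` lies between the `k`-th and the next of the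
parameters `1 / d₀ < 1 / d₁ < 1 / d₂`. -/
def signPattern (k : Fin 4) (i : Fin 3) : ℝ := if i.castSucc < k then -1 else 1

theorem signPattern_mul_self (k : Fin 4) (i : Fin 3) : signPattern k i * signPattern k i = 1 := by
  unfold signPattern; split_ifs <;> norm_num

theorem signPattern_zero : signPattern 0 = fun _ => 1 := by
  funext i; simp [signPattern]

theorem signPattern_three : signPattern 3 = fun _ => -1 := by
  funext i; fin_cases i <;> simp [signPattern]

theorem forall_signPattern_one {p : Fin 3 → ℝ} :
    (∀ i, 0 ≤ signPattern 1 i * p i) ↔ p 0 ≤ 0 ∧ 0 ≤ p 1 ∧ 0 ≤ p 2 := by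
  rw [Fin.forall_fin_succ, Fin.forall_fin_two]
  simp [signPattern]

theorem forall_signPattern_two {p : Fin 3 → ℝ} :
    (∀ i, 0 ≤ signPattern 2 i * p i) ↔ p 0 ≤ 0 ∧ p 1 ≤ 0 ∧ 0 ≤ p 2 := by
  rw [Fin.forall_fin_succ, Fin.forall_fin_two]
  simp [signPattern]

theorem pos_of_strictAnti (hd : StrictAnti d) (hd2 : 0 < d 2) : ∀ i, 0 < d i := fun i => hd2.trans_le (hd.antitone (Fin.le_last i))

/-- As `d` decreases, the signs of `1 - dᵢ t` are a block of minuses followed by pluses, and `m i ≥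
0` passes each sign on to `n i`. Where `1 - dᵢ t = 0`, the sign of `n i` decides; so two mirror
solutions at a removed pole go to the two adjacent branches. -/
theorem exists_mem_solutionBranch_signPattern (hd : StrictAnti d) (hd2 : 0 < d 2)
    (hm : ∀ i, 0 ≤ m i) {x : ℝ × (Fin 3 → ℝ)}
    (hx : x ∈ normalSolutions d m) : ∃ k, x ∈ solutionBranch d m (signPattern k) := by
  obtain ⟨t, n⟩ := x
  have hdp := pos_of_strictAnti hd hd2
  have hn := hx.2
  dsimp only at hn
  have hP : ∀ i, (0 ≤ n i ∧ 0 ≤ 1 - d i * t) ∨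
      (n i ≤ 0 ∧ 1 - d i * t ≤ 0 ∧ (1 - d i * t = 0 → n i < 0)) := by
    intro i
    have h1 := hn i ▸ hm i
    rcases lt_trichotomy (1 - d i * t) 0 with h | h | h
    · exact Or.inr ⟨nonpos_of_mul_nonneg_right h1 h, h.le, fun h' => absurd h' h.ne⟩
    · rcases le_or_gt 0 (n i) with h' | h'
      · exact Or.inl ⟨h', h.ge⟩
      · exact Or.inr ⟨h'.le, h.le, fun _ => h'⟩
    · exact Or.inl ⟨nonneg_of_mul_nonneg_right h1 h, h.le⟩
  have hmono : ∀ i j, i < j → 0 ≤ 1 - d i * t → 0 < 1 - d j * t := by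
    intro i j hij h
    rcases le_or_gt t 0 with ht | ht
    · nlinarith [hdp j]
    · nlinarith [hd hij]
  have key : ∀ k : Fin 4, (∀ i : Fin 3, (i.castSucc < k → n i ≤ 0 ∧ 1 - d i * t ≤ 0) ∧
      (¬ i.castSucc < k → 0 ≤ n i ∧ 0 ≤ 1 - d i * t)) →
      (t, n) ∈ solutionBranch d m (signPattern k) := by
    intro k h
    refine ⟨hx, fun i => ?_⟩
    dsimp only
    unfold signPattern
    split_ifs with hi
    · have := (h i).1 hi
      constructor <;> linarith
    · have := (h i).2 hi
      constructor <;> linarith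
  have up : ∀ i j, i < j → 0 ≤ 1 - d i * t → 0 ≤ n j ∧ 0 ≤ 1 - d j * t := by
    intro i j hij h
    have h1 := hmono i j hij h
    exact ⟨nonneg_of_mul_nonneg_right (hn j ▸ hm j) h1, h1.le⟩
  rcases hP 0 with h0 | h0
  · refine ⟨0, key 0 fun i => ⟨fun h => absurd h (by simp), fun _ => ?_⟩⟩
    rcases eq_or_ne i 0 with rfl | hi
    · exact h0
    · exact up 0 i (Fin.pos_iff_ne_zero.2 hi) h0.2
  rcases hP 1 with h1 | h1
  · refine ⟨1, key 1 (Fin.forall_fin_succ.2 ⟨⟨fun _ => ⟨h0.1, h0.2.1⟩, fun h => absurd (by decide) h⟩,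
      Fin.forall_fin_two.2 ⟨⟨fun h => absurd h (by decide), fun _ => h1⟩,
        ⟨fun h => absurd h (by decide), fun _ => up 1 2 (by decide) h1.2⟩⟩⟩)⟩
  rcases hP 2 with h2 | h2
  · refine ⟨2, key 2 (Fin.forall_fin_succ.2 ⟨⟨fun _ => ⟨h0.1, h0.2.1⟩, fun h => absurd (by decide) h⟩,
      Fin.forall_fin_two.2 ⟨⟨fun _ => ⟨h1.1, h1.2.1⟩, fun h => absurd (by decide) h⟩,
        ⟨fun h => absurd h (by decide), fun _ => h2⟩⟩⟩)⟩
  · refine ⟨3, key 3 (Fin.forall_fin_succ.2 ⟨⟨fun _ => ⟨h0.1, h0.2.1⟩, fun h => absurd (by decide) h⟩,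
      Fin.forall_fin_two.2 ⟨⟨fun _ => ⟨h1.1, h1.2.1⟩, fun h => absurd (by decide) h⟩,
        ⟨fun _ => ⟨h2.1, h2.2.1⟩, fun h => absurd (by decide) h⟩⟩⟩)⟩

theorem eq_zero_of_mem_both {j k : Fin 4} {i : Fin 3} (hj : ¬ i.castSucc < j) (hk : i.castSucc < k)
    {x : ℝ × (Fin 3 → ℝ)} (hxj : x ∈ solutionBranch d m (signPattern j))
    (hxk : x ∈ solutionBranch d m (signPattern k)) : x.2 i = 0 ∧ 1 - d i * x.1 = 0 := by
  have h1 := hxj.2 i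
  have h2 := hxk.2 i
  simp only [signPattern, hj, hk, if_true, if_false] at h1 h2
  constructor <;> linarith

/-- A common point would make `1 - dᵢ t` vanish for two different `dᵢ`. -/
theorem disjoint_solutionBranch_far (hd : StrictAnti d) {j k : Fin 4} {i₁ i₂ : Fin 3} (hi : i₁ < i₂)
    (hj : ¬ i₁.castSucc < j) (hk : i₂.castSucc < k) :
    Disjoint (solutionBranch d m (signPattern j)) (solutionBranch d m (signPattern k)) := by
  rw [Set.disjoint_left]
  intro x hxj hxk
  have hi' : i₁.castSucc < i₂.castSucc := hi
  have h1 := (eq_zero_of_mem_both hj (hi'.trans hk) hxj hxk).2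
  have h2 := (eq_zero_of_mem_both (fun h => hj (hi'.trans h)) hk hxj hxk).2
  have h3 : (d i₁ - d i₂) * x.1 = 0 := by linarith
  rcases mul_eq_zero.1 h3 with h4 | h4
  · exact (hd hi).ne' (sub_eq_zero.1 h4)
  · rw [h4] at h1; simp at h1

/-- Neighbouring branches are disjoint if there are short vectors on both of them. -/
theorem disjoint_solutionBranch_near (hd : StrictAnti d) (hd2 : 0 < d 2) (hm : ∀ i, 0 ≤ m i)
    (j : Fin 3) {t t' : ℝ} (ht : IsShortAt d m t)
    (hs : ∀ i, 0 ≤ signPattern j.castSucc i * (1 - d i * t)) (ht' : IsShortAt d m t')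
    (hs' : ∀ i, 0 ≤ signPattern j.succ i * (1 - d i * t')) :
    Disjoint (solutionBranch d m (signPattern j.castSucc))
      (solutionBranch d m (signPattern j.succ)) := by
  rw [Set.disjoint_left]
  rintro ⟨r, n⟩ hxj hxk
  have hdp := pos_of_strictAnti hd hd2
  obtain ⟨hnj, hDj⟩ := eq_zero_of_mem_both (i := j) (lt_irrefl _) (Fin.castSucc_lt_succ) hxj hxk
  dsimp only at hnj hDj
  have hmj : m j = 0 := by
    have := hxj.1.2 j
    dsimp only at this
    rw [this, hDj, zero_mul]
  have hsame : ∀ i, i ≠ j → signPattern j.succ i = signPattern j.castSucc i := by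
    intro i hij
    have : i.castSucc < j.succ ↔ i.castSucc < j.castSucc := by
      rw [Fin.castSucc_lt_succ_iff, Fin.castSucc_lt_castSucc_iff]
      exact ⟨fun h => lt_of_le_of_ne h hij, le_of_lt⟩
    simp only [signPattern, this]
  have h1 : t < r := by
    have h2 := hs j
    simp only [signPattern, lt_irrefl, if_false, one_mul] at h2
    have h3 := h2.lt_of_ne (ht.1 j).symm
    exact lt_of_mul_lt_mul_left (by linarith) (hdp j).le
  have h2 : r < t' := by
    have h2 := hs' j
    simp only [signPattern, Fin.castSucc_lt_succ, if_true] at h2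
    have h3 := (show 1 - d j * t' ≤ 0 by linarith).lt_of_ne (ht'.1 j)
    exact lt_of_mul_lt_mul_left (by linarith) (hdp j).le
  have h13 : 0 < t' - t := by linarith
  have hε := signPattern_mul_self j.castSucc
  set ε := signPattern j.castSucc with hεdef
  have hsq : ∀ i, ε i ^ 2 = 1 := fun i => by rw [sq, hε]
  have hs'' : ∀ i, i ≠ j → 0 ≤ ε i * (1 - d i * t') := fun i hi => hsame i hi ▸ hs' i
  -- A common point has `m j = n j = 0`, so the `j`-th coordinate plays no role, and no other sign
  -- changes between `t` and `t'`. Convexity in the other coordinates makes `n` too short. The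
  -- values `0` and `1` at `j` are placeholders meeting the requirement `x j ≠ y j`.
  have := sum_sq_lt_one_of_between (x := fun i => if i = j then 0 else ε i * (1 - d i * t))
    (y := fun i => if i = j then 1 else ε i * (1 - d i * t')) (μ := m)
    (p := fun i => ε i * (m i / (1 - d i * t))) (q := fun i => ε i * (m i / (1 - d i * t')))
    (w := fun i => ε i * n i) (s := (r - t) / (t' - t))
    (div_pos (by linarith) h13) ((div_lt_one h13).2 (by linarith)) (fun i => ?_)
    (fun i => ?_) (fun i => ?_) (fun i => sign_mul_div_nonneg (hm i) (hs i)) (fun i => ?_) hm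
    (fun i => ?_) (fun i => ?_) (fun i => ?_) (by rw [sum_sq_sign_mul hε]; exact ht.2.le)
    (by rw [sum_sq_sign_mul hε]; exact ht'.2.le)
  · rw [sum_sq_sign_mul hε] at this
    exact this.ne hxj.1.1
  · split_ifs
    exacts [le_rfl, hs i]
  · split_ifs with hi
    exacts [zero_le_one, hs'' i hi]
  · split_ifs
    · exact zero_ne_one
    · intro h
      have h4 := congrArg (fun z => ε i * z) h
      simp only [← mul_assoc, hε, one_mul] at h4
      have : d i * (t' - t) = 0 := by linarith
      rcases mul_eq_zero.1 this with h | h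
      · exact (hdp i).ne' h
      · exact h13.ne' h
  · rcases eq_or_ne i j with rfl | hi
    · rw [hmj]; simp
    · exact sign_mul_div_nonneg (hm i) (hs'' i hi)
  · split_ifs with hi
    · rw [hi, hmj, zero_mul]
    · have := ht.1 i
      field_simp
      rw [hsq, mul_one]
  · split_ifs with hi
    · rw [hi, hmj]; simp
    · have := ht'.1 i
      field_simp
      rw [hsq, mul_one]
  · split_ifs with hi
    · rw [hi, hmj, hnj]; simp
    · have e : (1 - (r - t) / (t' - t)) * (ε i * (1 - d i * t)) +
          (r - t) / (t' - t) * (ε i * (1 - d i * t')) = ε i * (1 - d i * r) := by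
        field_simp
        ring
      have h5 := hxj.1.2 i
      dsimp only at h5
      rw [e, h5]
      linear_combination -(1 - d i * r) * n i * hsq i

end
-- Counting positive solutions.
section
variable {d m : Fin 3 → ℝ}

/-- The value at `t = 0` is `m`. If it is short, it excludes a second positive solution; if not, it
would be a long vector between a short one far to the left and any positive solution. -/
theorem branch_zero_pos_encard (hd : StrictAnti d) (hd2 : 0 < d 2) (hm : ∀ i, 0 ≤ m i) :
    {x ∈ solutionBranch d m (signPattern 0) | 0 < x.1}.encard =
      if ∑ i, m i ^ 2 < 1 then 1 else 0 := by
  have hdp := pos_of_strictAnti hd hd2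
  have hε := signPattern_mul_self 0
  split_ifs with h
  · refine le_antisymm (encard_le_one_of_fst
      (fun x hx y hy => solutionBranch_inj hd.injective hε x hx.1 y hy.1) ?_) ?_
    · rintro x ⟨hx, hx0⟩ y ⟨hy, -⟩ hxy
      have h0 := (isShortAt_zero (d := d) h).weak (ε := signPattern 0) hm
        (by simp [signPattern_zero])
      exact not_between hdp hm hε hx0 hxy h0.1 h0.2.1 h0.2.2 hx.1.1.ge hx.1.2 hy.1.1.le hy.1.2 hy.2
    · rw [Set.one_le_encard_iff_nonempty, signPattern_zero]
      obtain ⟨x, hx⟩ := exists_pos_mem_branch_one hdp hm h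
      exact ⟨x, hx⟩
  · rw [Set.encard_eq_zero, Set.eq_empty_iff_forall_notMem]
    rintro x ⟨hx, hx0⟩
    obtain ⟨t, ht, h1, h2⟩ := exists_isShortAt_neg hdp m 0 le_rfl
    have h0 := h1.weak (ε := signPattern 0) hm (by simpa [signPattern_zero] using h2)
    exact not_between hdp hm hε ht hx0 h0.1 h0.2.1 h0.2.2 (n₂ := m) (not_lt.1 h) (by simp)
      hx.1.1.le hx.1.2 hx.2

/-- The branch is unbounded to the right, where vectors become short; convexity then leaves room for
one solution only. -/
theorem branch_three_encard (hd : StrictAnti d) (hd2 : 0 < d 2) (hm : ∀ i, 0 ≤ m i) :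
    (solutionBranch d m (signPattern 3)).encard = 1 := by
  have hdp := pos_of_strictAnti hd hd2
  have hε := signPattern_mul_self 3
  refine le_antisymm (encard_le_one_of_fst (solutionBranch_inj hd.injective hε) ?_) ?_
  · intro x hx y hy hxy
    obtain ⟨t, ht, h1, h2⟩ := exists_isShortAt_pos hdp m y.1
    have h0 := h1.weak (ε := signPattern 3) hm (by simpa [signPattern_three] using h2)
    exact not_between hdp hm hε hxy ht hx.1.1.le hx.1.2 hx.2 hy.1.1.ge hy.1.2 h0.1 h0.2.1 h0.2.2
  · rw [Set.one_le_encard_iff_nonempty, signPattern_three]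
    exact exists_mem_branch_neg_one hdp hm

/-- The branch lives on `[1 / d 0, 1 / d 1]`, bounded by poles on both sides. -/
theorem branch_one_encard (hd : StrictAnti d) (hd2 : 0 < d 2) (hm : ∀ i, 0 ≤ m i)
    {t : ℝ} (ht : IsShortAt d m t) (hs : ∀ i, 0 ≤ signPattern 1 i * (1 - d i * t)) :
    (solutionBranch d m (signPattern 1)).encard = 2 := by
  have hdp := pos_of_strictAnti hd hd2
  have h01 : d 1 < d 0 := hd (by decide)
  have h12 : d 2 < d 1 := hd (by decide)
  have hs' := forall_signPattern_one.1 hs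
  refine solutionBranch_encard_eq_two (T := 1 / d 1) (T' := 1 / d 0) hdp hd.injective hm
    (signPattern_mul_self 1) ht hs ?_ (forall_signPattern_one.2 ⟨?_, ?_, ?_⟩) ⟨1, ?_⟩ ?_
    (forall_signPattern_one.2 ⟨?_, ?_, ?_⟩) ⟨0, ?_⟩
  · rw [le_div_iff₀ (hdp 1)]; linarith [hs'.2.1]
  · rw [mul_one_div, sub_nonpos, one_le_div (hdp 1)]; exact h01.le
  · rw [mul_one_div, sub_nonneg, div_le_one (hdp 1)]
  · rw [mul_one_div, sub_nonneg, div_le_one (hdp 1)]; exact h12.le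
  · rw [mul_one_div_cancel (hdp 1).ne', sub_self]
  · rw [div_le_iff₀ (hdp 0)]; linarith [hs'.1]
  · rw [mul_one_div, sub_nonpos, one_le_div (hdp 0)]
  · rw [mul_one_div, sub_nonneg, div_le_one (hdp 0)]; exact h01.le
  · rw [mul_one_div, sub_nonneg, div_le_one (hdp 0)]; exact (h12.trans h01).le
  · rw [mul_one_div_cancel (hdp 0).ne', sub_self]

theorem branch_two_encard (hd : StrictAnti d) (hd2 : 0 < d 2) (hm : ∀ i, 0 ≤ m i)
    {t : ℝ} (ht : IsShortAt d m t) (hs : ∀ i, 0 ≤ signPattern 2 i * (1 - d i * t)) :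
    (solutionBranch d m (signPattern 2)).encard = 2 := by
  have hdp := pos_of_strictAnti hd hd2
  have h01 : d 1 < d 0 := hd (by decide)
  have h12 : d 2 < d 1 := hd (by decide)
  have hs' := forall_signPattern_two.1 hs
  refine solutionBranch_encard_eq_two (T := 1 / d 2) (T' := 1 / d 1) hdp hd.injective hm
    (signPattern_mul_self 2) ht hs ?_ (forall_signPattern_two.2 ⟨?_, ?_, ?_⟩) ⟨2, ?_⟩ ?_
    (forall_signPattern_two.2 ⟨?_, ?_, ?_⟩) ⟨1, ?_⟩
  · rw [le_div_iff₀ (hdp 2)]; linarith [hs'.2.2]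
  · rw [mul_one_div, sub_nonpos, one_le_div (hdp 2)]; exact (h12.trans h01).le
  · rw [mul_one_div, sub_nonpos, one_le_div (hdp 2)]; exact h12.le
  · rw [mul_one_div, sub_nonneg, div_le_one (hdp 2)]
  · rw [mul_one_div_cancel (hdp 2).ne', sub_self]
  · rw [div_le_iff₀ (hdp 1)]; linarith [hs'.2.1]
  · rw [mul_one_div, sub_nonpos, one_le_div (hdp 1)]; exact h01.le
  · rw [mul_one_div, sub_nonpos, one_le_div (hdp 1)]
  · rw [mul_one_div, sub_nonneg, div_le_one (hdp 1)]; exact h12.le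
  · rw [mul_one_div_cancel (hdp 1).ne', sub_self]

/-- There is a short vector at a parameter with the sign pattern `k`. -/
def HasShort (d m : Fin 3 → ℝ) (k : Fin 4) : Prop :=
  ∃ t, IsShortAt d m t ∧ ∀ i, 0 ≤ signPattern k i * (1 - d i * t)

/-- There is a solution at a parameter with the sign pattern `k`. -/
def HasSolution (d m : Fin 3 → ℝ) (k : Fin 4) : Prop :=
  ∃ x ∈ normalSolutions d m, ∀ i, 0 ≤ signPattern k i * (1 - d i * x.1)

theorem hasShort_zero (hd : ∀ i, 0 < d i) : HasShort d m 0 := by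
  obtain ⟨t, -, h1, h2⟩ := exists_isShortAt_neg hd m 0 le_rfl
  exact ⟨t, h1, by simpa [signPattern_zero] using h2⟩

theorem hasShort_three (hd : ∀ i, 0 < d i) : HasShort d m 3 := by
  obtain ⟨t, -, h1, h2⟩ := exists_isShortAt_pos hd m 0
  exact ⟨t, h1, by simpa [signPattern_three] using h2⟩

theorem branch_eq_empty {k : Fin 4} (h : ¬ HasSolution d m k) :
    solutionBranch d m (signPattern k) = ∅ :=
  Set.eq_empty_iff_forall_notMem.2 fun x hx => h ⟨x, hx.1, fun i => (hx.2 i).2⟩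

theorem disjoint_branch_near (hd : StrictAnti d) (hd2 : 0 < d 2) (hm : ∀ i, 0 ≤ m i) (j : Fin 3)
    (h : HasShort d m j.castSucc) (h' : HasShort d m j.succ) :
    Disjoint (solutionBranch d m (signPattern j.castSucc))
      (solutionBranch d m (signPattern j.succ)) := by
  obtain ⟨t, ht, hs⟩ := h
  obtain ⟨t', ht', hs'⟩ := h'
  exact disjoint_solutionBranch_near hd hd2 hm j ht hs ht' hs'

/-- The base number in terms of the vector `m`. -/
noncomputable def shortBase (m : Fin 3 → ℝ) : ℕ∞ := if ∑ i, m i ^ 2 < 1 then 2 else 1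

/-- Only the all-plus pattern admits `t ≤ 0`. The two outer branches are grouped together because
they alone carry the base number. -/
theorem posSolutions_eq (hd : StrictAnti d) (hd2 : 0 < d 2) (hm : ∀ i, 0 ≤ m i) :
    {x ∈ normalSolutions d m | 0 < x.1} =
      {x ∈ solutionBranch d m (signPattern 0) | 0 < x.1} ∪ solutionBranch d m (signPattern 3) ∪
        solutionBranch d m (signPattern 1) ∪ solutionBranch d m (signPattern 2) := by
  have hdp := pos_of_strictAnti hd hd2
  ext x
  constructor
  · rintro ⟨hx, h0⟩
    obtain ⟨k, hk⟩ := exists_mem_solutionBranch_signPattern hd hd2 hm hx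
    fin_cases k
    · exact Or.inl (Or.inl (Or.inl ⟨hk, h0⟩))
    · exact Or.inl (Or.inr hk)
    · exact Or.inr hk
    · exact Or.inl (Or.inl (Or.inr hk))
  · rintro (((⟨hx, h0⟩ | hx) | hx) | hx)
    · exact ⟨hx.1, h0⟩
    · exact ⟨hx.1, pos_of_mem_branch (i := 0) hdp hx (by simp [signPattern])⟩
    · exact ⟨hx.1, pos_of_mem_branch (i := 0) hdp hx (by simp [signPattern])⟩
    · exact ⟨hx.1, pos_of_mem_branch (i := 0) hdp hx (by simp [signPattern])⟩

theorem base_union_encard (hd : StrictAnti d) (hd2 : 0 < d 2) (hm : ∀ i, 0 ≤ m i) :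
    ({x ∈ solutionBranch d m (signPattern 0) | 0 < x.1} ∪
      solutionBranch d m (signPattern 3)).encard = shortBase m := by
  rw [Set.encard_union_eq, branch_zero_pos_encard hd hd2 hm, branch_three_encard hd hd2 hm,
    shortBase]
  · split_ifs <;> norm_num
  · exact (disjoint_solutionBranch_far hd (i₁ := 0) (i₂ := 2) (by decide) (by decide)
      (by decide)).mono_left (Set.sep_subset _ _)

theorem disjoint_base_one (hd : StrictAnti d) (hd2 : 0 < d 2) (hm : ∀ i, 0 ≤ m i)
    (h : HasShort d m 1) : Disjoint ({x ∈ solutionBranch d m (signPattern 0) | 0 < x.1} ∪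
      solutionBranch d m (signPattern 3)) (solutionBranch d m (signPattern 1)) := by
  refine Set.disjoint_union_left.2 ⟨Disjoint.mono_left (Set.sep_subset _ _)
    (disjoint_branch_near hd hd2 hm 0 (hasShort_zero (pos_of_strictAnti hd hd2)) h), ?_⟩
  exact (disjoint_solutionBranch_far hd (i₁ := 1) (i₂ := 2) (by decide) (by decide)
      (by decide)).symm

theorem disjoint_base_two (hd : StrictAnti d) (hd2 : 0 < d 2) (hm : ∀ i, 0 ≤ m i)
    (h : HasShort d m 2) : Disjoint ({x ∈ solutionBranch d m (signPattern 0) | 0 < x.1} ∪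
      solutionBranch d m (signPattern 3)) (solutionBranch d m (signPattern 2)) := by
  refine Set.disjoint_union_left.2 ⟨Disjoint.mono_left (Set.sep_subset _ _) ?_,
    (disjoint_branch_near hd hd2 hm 2 h (hasShort_three (pos_of_strictAnti hd hd2))).symm⟩
  exact (disjoint_solutionBranch_far hd (i₁ := 0) (i₂ := 1) (by decide) (by decide)
      (by decide))

theorem posSolutions_encard_le_six (hd : StrictAnti d) (hd2 : 0 < d 2) (hm : ∀ i, 0 ≤ m i) :
    {x ∈ normalSolutions d m | 0 < x.1}.encard ≤ 6 := by
  have hdp := pos_of_strictAnti hd hd2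
  rw [posSolutions_eq hd hd2 hm]
  have h0 : shortBase m ≤ 2 := by
    unfold shortBase; split_ifs <;> norm_num
  calc _ ≤ shortBase m + 2 + 2 := (Set.encard_union_le _ _).trans (add_le_add
        ((Set.encard_union_le _ _).trans (add_le_add (base_union_encard hd hd2 hm).le
          (solutionBranch_encard_le hdp hd.injective hm (signPattern_mul_self 1))))
        (solutionBranch_encard_le hdp hd.injective hm (signPattern_mul_self 2)))
    _ ≤ 2 + 2 + 2 := by gcongr
    _ = 6 := by norm_num

theorem posSolutions_encard_of_not (hd : StrictAnti d) (hd2 : 0 < d 2) (hm : ∀ i, 0 ≤ m i)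
    (h1 : ¬ HasSolution d m 1) (h2 : ¬ HasSolution d m 2) :
    {x ∈ normalSolutions d m | 0 < x.1}.encard = shortBase m := by
  rw [posSolutions_eq hd hd2 hm, branch_eq_empty h1, branch_eq_empty h2, Set.union_empty,
    Set.union_empty, base_union_encard hd hd2 hm]

theorem le_posSolutions_encard (hd : StrictAnti d) (hd2 : 0 < d 2) (hm : ∀ i, 0 ≤ m i)
    (h : HasShort d m 1 ∨ HasShort d m 2) :
    shortBase m + 2 ≤ {x ∈ normalSolutions d m | 0 < x.1}.encard := by
  rw [posSolutions_eq hd hd2 hm, ← base_union_encard hd hd2 hm]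
  rcases h with h | h
  · have h' := h
    obtain ⟨t, ht, hs⟩ := h'
    rw [← branch_one_encard hd hd2 hm ht hs, ← Set.encard_union_eq (disjoint_base_one hd hd2 hm h)]
    exact Set.encard_le_encard Set.subset_union_left
  · have h' := h
    obtain ⟨t, ht, hs⟩ := h'
    rw [← branch_two_encard hd hd2 hm ht hs, ← Set.encard_union_eq (disjoint_base_two hd hd2 hm h)]
    exact Set.encard_le_encard (Set.union_subset_union_left _ Set.subset_union_left)

theorem posSolutions_encard_of_one (hd : StrictAnti d) (hd2 : 0 < d 2) (hm : ∀ i, 0 ≤ m i)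
    (h : (HasShort d m 1 ∧ ¬ HasSolution d m 2) ∨ (HasShort d m 2 ∧ ¬ HasSolution d m 1)) :
    {x ∈ normalSolutions d m | 0 < x.1}.encard = shortBase m + 2 := by
  rw [posSolutions_eq hd hd2 hm, ← base_union_encard hd hd2 hm]
  rcases h with ⟨h, h'⟩ | ⟨h, h'⟩
  · rw [branch_eq_empty h', Set.union_empty, Set.encard_union_eq (disjoint_base_one hd hd2 hm h)]
    obtain ⟨t, ht, hs⟩ := h
    rw [branch_one_encard hd hd2 hm ht hs]
  · rw [branch_eq_empty h', Set.union_empty, Set.encard_union_eq (disjoint_base_two hd hd2 hm h)]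
    obtain ⟨t, ht, hs⟩ := h
    rw [branch_two_encard hd hd2 hm ht hs]

theorem posSolutions_encard_of_both (hd : StrictAnti d) (hd2 : 0 < d 2) (hm : ∀ i, 0 ≤ m i)
    (h1 : HasShort d m 1) (h2 : HasShort d m 2) :
    {x ∈ normalSolutions d m | 0 < x.1}.encard = shortBase m + 4 := by
  rw [posSolutions_eq hd hd2 hm, ← base_union_encard hd hd2 hm, Set.encard_union_eq,
    Set.encard_union_eq (disjoint_base_one hd hd2 hm h1)]
  · obtain ⟨t, ht, hs⟩ := h1
    obtain ⟨t', ht', hs'⟩ := h2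
    rw [branch_one_encard hd hd2 hm ht hs, branch_two_encard hd hd2 hm ht' hs', add_assoc]
    norm_num
  · exact Set.disjoint_union_left.2 ⟨disjoint_base_two hd hd2 hm h2,
      disjoint_branch_near hd hd2 hm 1 h1 h2⟩

end
-- Neutral points as solutions of the normalized equation.
/-- The points of the null cone at which the gradient `A r - M` is proportional to `r`. -/
def nullStationary (A : Matrix (Fin 4) (Fin 4) ℝ) (M : FourVec) : Set FourVec :=
  {r | r ∈ futureNull ∧ ∃ ζ : ℝ, A.mulVec r - M = ζ • r}

/-- The ratios of the spatial coordinates to the time coordinate in a frame. -/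
noncomputable def coordRatio (u₀ : FourVec) (u : Fin 3 → FourVec) (M : FourVec) : Fin 3 → ℝ :=
  fun i => -mink (u i) M / mink u₀ M

/-- The null vector with time coordinate `c t` and direction `n`. -/
noncomputable def toNull (u₀ : FourVec) (u : Fin 3 → FourVec) (c : ℝ) (x : ℝ × (Fin 3 → ℝ)) :
    FourVec :=
  (c * x.1) • u₀ + ∑ i, (c * x.1 * x.2 i) • u i

namespace IsEigenframe
variable {A Λ : Matrix (Fin 4) (Fin 4) ℝ} {l₀ : ℝ} {l : Fin 3 → ℝ} {u₀ : FourVec}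
  {u : Fin 3 → FourVec} {M : FourVec}

theorem mulVec_eq (h : IsEigenframe A l₀ l u₀ u) (r : FourVec) :
    A.mulVec r = (l₀ * mink u₀ r) • u₀ + ∑ i, (l i * -mink (u i) r) • u i := by
  conv_lhs => rw [h.expand r]
  rw [Matrix.mulVec_add, Matrix.mulVec_smul, h.eig₀, Matrix.mulVec_sum, smul_smul, mul_comm l₀]
  congr 1
  refine Finset.sum_congr rfl fun i _ => ?_
  rw [Matrix.mulVec_smul, h.eig, smul_smul, mul_comm]

theorem mink_zero_mulVec (h : IsEigenframe A l₀ l u₀ u) (r : FourVec) :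
    mink u₀ (A.mulVec r) = l₀ * mink u₀ r := by
  rw [h.mulVec_eq, h.mink_zero_combination]

theorem mink_mulVec (h : IsEigenframe A l₀ l u₀ u) (r : FourVec) (i : Fin 3) :
    mink (u i) (A.mulVec r) = l i * mink (u i) r := by
  rw [h.mulVec_eq, h.mink_combination]; ring

theorem time_eq (h : IsEigenframe A l₀ l u₀ u) {r : FourVec} {ζ : ℝ}
    (hr : A.mulVec r - M = ζ • r) : (l₀ - ζ) * mink u₀ r = mink u₀ M := by
  have := congrArg (mink u₀) hr
  rw [mink_sub_right, mink_smul_right, h.mink_zero_mulVec] at this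
  linarith

theorem space_eq (h : IsEigenframe A l₀ l u₀ u) {r : FourVec} {ζ : ℝ}
    (hr : A.mulVec r - M = ζ • r) (i : Fin 3) : (l i - ζ) * mink (u i) r = mink (u i) M := by
  have := congrArg (mink (u i)) hr
  rw [mink_sub_right, mink_smul_right, h.mink_mulVec] at this
  linarith

theorem sum_sq_eq (h : IsLorentzFrame u₀ u) {r : FourVec} (hr : mink r r = 0) :
    ∑ i, mink (u i) r ^ 2 = mink u₀ r ^ 2 := by
  rw [h.mink_eq_coords] at hr
  simp only [← sq, neg_sq] at hr
  linarith

theorem mem_futureNull_iff (h : IsLorentzFrame u₀ u) {r : FourVec} :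
    r ∈ futureNull ↔ 0 < mink u₀ r ∧ mink r r = 0 := by
  constructor
  · rintro ⟨h1, h2⟩
    exact ⟨(h.time_pos_iff h2.ge).1 h1, h2⟩
  · rintro ⟨h1, h2⟩
    exact ⟨(h.time_pos_iff h2.ge).2 h1, h2⟩

/-- The substitution is `t = 1 / (l₀ - ζ)` and `n` the ratio of space to time coordinates of `r`.
The time equation `(l₀ - ζ) r₀ = M₀` excludes `ζ = l₀` and gives `r₀ = M₀ t`. -/
theorem exists_solution (h : IsEigenframe A l₀ l u₀ u) (hc : mink u₀ M ≠ 0) {r : FourVec}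
    (hr0 : r ∈ futureNull) {ζ : ℝ} (hr : A.mulVec r - M = ζ • r) :
    ∃ x ∈ normalSolutions (fun i => l₀ - l i) (coordRatio u₀ u M), x.1 = (l₀ - ζ)⁻¹ ∧
      0 < mink u₀ M * x.1 ∧ toNull u₀ u (mink u₀ M) x = r := by
  obtain ⟨h1, h2⟩ := (mem_futureNull_iff h.toIsLorentzFrame).1 hr0
  have h3 := h.time_eq hr
  have hζ : l₀ - ζ ≠ 0 := by
    intro h'
    rw [h', zero_mul] at h3
    exact hc h3.symm
  have h4 : mink u₀ M * (l₀ - ζ)⁻¹ = mink u₀ r := by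
    rw [← h3]; field_simp
  refine ⟨((l₀ - ζ)⁻¹, fun i => -mink (u i) r / mink u₀ r), ⟨?_, fun i => ?_⟩, rfl, ?_, ?_⟩
  · simp only [div_pow, neg_sq]
    rw [← Finset.sum_div, sum_sq_eq h.toIsLorentzFrame h2, div_self (by positivity)]
  · dsimp only [coordRatio]
    rw [← h.space_eq hr i, ← h3]
    field_simp
    ring
  · rw [h4]; exact h1
  · conv_rhs => rw [h.expand r]
    simp only [toNull]
    rw [h4]
    congr 1
    refine Finset.sum_congr rfl fun i _ => ?_
    rw [mul_div_cancel₀ _ h1.ne']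

theorem toNull_mem (h : IsEigenframe A l₀ l u₀ u) {x : ℝ × (Fin 3 → ℝ)}
    (hx : x ∈ normalSolutions (fun i => l₀ - l i) (coordRatio u₀ u M))
    (hpos : 0 < mink u₀ M * x.1) :
    toNull u₀ u (mink u₀ M) x ∈ futureNull ∧
      A.mulVec (toNull u₀ u (mink u₀ M) x) - M =
        (l₀ - x.1⁻¹) • toNull u₀ u (mink u₀ M) x := by
  obtain ⟨hc, ht⟩ := mul_ne_zero_iff.1 hpos.ne'
  have e0 : mink u₀ (toNull u₀ u (mink u₀ M) x) = mink u₀ M * x.1 :=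
    h.mink_zero_combination _ _
  have ei : ∀ i, mink (u i) (toNull u₀ u (mink u₀ M) x) = -(mink u₀ M * x.1 * x.2 i) :=
    fun i => h.mink_combination _ _ i
  constructor
  · rw [mem_futureNull_iff h.toIsLorentzFrame]
    refine ⟨e0 ▸ hpos, ?_⟩
    rw [h.mink_eq_coords]
    simp only [e0, ei, neg_neg]
    have : ∑ i, mink u₀ M * x.1 * x.2 i * (mink u₀ M * x.1 * x.2 i) =
        (mink u₀ M * x.1) ^ 2 * ∑ i, x.2 i ^ 2 := by
      rw [Finset.mul_sum]
      exact Finset.sum_congr rfl fun i _ => by ring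
    rw [this, hx.1]
    ring
  · refine h.ext ?_ fun i => ?_
    · rw [mink_sub_right, mink_smul_right, h.mink_zero_mulVec, e0]
      field_simp
    · rw [mink_sub_right, mink_smul_right, h.mink_mulVec, ei]
      have h1 := hx.2 i
      dsimp only [coordRatio] at h1
      rw [div_eq_iff hc] at h1
      have h2 : mink (u i) M = -((1 - (l₀ - l i) * x.1) * x.2 i * mink u₀ M) := by
        rw [← h1, neg_neg]
      rw [h2]
      field_simp
      ring

theorem nullStationary_encard (h : IsEigenframe A l₀ l u₀ u) (hc : mink u₀ M ≠ 0) :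
    (nullStationary A M).encard =
      {x ∈ normalSolutions (fun i => l₀ - l i) (coordRatio u₀ u M) |
        0 < mink u₀ M * x.1}.encard := by
  have himg : nullStationary A M = toNull u₀ u (mink u₀ M) ''
      {x ∈ normalSolutions (fun i => l₀ - l i) (coordRatio u₀ u M) | 0 < mink u₀ M * x.1} := by
    ext r
    constructor
    · rintro ⟨h1, ζ, h2⟩
      obtain ⟨x, hx, -, hx1, rfl⟩ := h.exists_solution hc h1 h2
      exact ⟨x, ⟨hx, hx1⟩, rfl⟩
    · rintro ⟨x, ⟨hx, hx1⟩, rfl⟩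
      obtain ⟨h1, h2⟩ := h.toNull_mem hx hx1
      exact ⟨h1, _, h2⟩
  rw [himg, Set.InjOn.encard_image]
  rintro x ⟨-, hx⟩ y - hxy
  have e0 := congrArg (mink u₀) hxy
  simp only [toNull, h.mink_zero_combination] at e0
  have e1 : x.1 = y.1 := mul_left_cancel₀ hc e0
  refine Prod.ext e1 (funext fun i => ?_)
  have ei := congrArg (mink (u i)) hxy
  simp only [toNull, h.mink_combination, ← e0] at ei
  exact mul_left_cancel₀ hx.ne' (neg_injective ei)

theorem nullStationary_encard_pos (h : IsEigenframe A l₀ l u₀ u) (hc : 0 < mink u₀ M) :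
    (nullStationary A M).encard =
      {x ∈ normalSolutions (fun i => l₀ - l i) (coordRatio u₀ u M) | 0 < x.1}.encard := by
  simp only [h.nullStationary_encard hc.ne', mul_pos_iff_of_pos_left hc]

theorem nullStationary_encard_neg (h : IsEigenframe A l₀ l u₀ u) (hc : mink u₀ M < 0) :
    (nullStationary A M).encard =
      {x ∈ normalSolutions (fun i => l₀ - l i) (coordRatio u₀ u M) | x.1 < 0}.encard := by
  simp only [h.nullStationary_encard hc.ne, mul_pos_iff, hc, hc.not_gt, true_and, false_and,
    false_or]

theorem mink_self_eq (h : IsLorentzFrame u₀ u) (hc : mink u₀ M ≠ 0) :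
    mink M M = mink u₀ M ^ 2 * (1 - ∑ i, coordRatio u₀ u M i ^ 2) := by
  rw [h.mink_eq_coords M M, mul_sub, Finset.mul_sum]
  congr 1
  · ring
  · refine Finset.sum_congr rfl fun i _ => ?_
    rw [coordRatio, div_pow, mul_div_cancel₀ _ (pow_ne_zero 2 hc)]
    ring

theorem mem_insideFutureCone_iff (h : IsLorentzFrame u₀ u) :
    M ∈ insideFutureCone ↔ 0 < mink u₀ M ∧ ∑ i, coordRatio u₀ u M i ^ 2 < 1 := by
  constructor
  · rintro ⟨h1, h2⟩
    have h3 := (h.time_pos_iff h2.le).1 h1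
    rw [mink_self_eq h h3.ne'] at h2
    have := pos_of_mul_pos_right h2 (by positivity)
    exact ⟨h3, by linarith⟩
  · rintro ⟨h1, h2⟩
    have h3 : 0 < mink M M := by
      rw [mink_self_eq h h1.ne']
      have := sub_pos.2 h2
      positivity
    exact ⟨(h.time_pos_iff h3.le).2 h1, h3⟩

theorem baseNumber_eq (h : IsLorentzFrame u₀ u) (hc : 0 < mink u₀ M) :
    baseNumber M = shortBase (coordRatio u₀ u M) := by
  simp only [baseNumber, shortBase, mem_insideFutureCone_iff h, hc, true_and]

theorem baseNumber_eq_one (h : IsLorentzFrame u₀ u) (hc : mink u₀ M ≤ 0) : baseNumber M = 1 := by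
  simp only [baseNumber, mem_insideFutureCone_iff h, hc.not_gt, false_and, if_false]

theorem mink_self_neg (h : IsLorentzFrame u₀ u) (hM : M ∉ pastCone) (hc : mink u₀ M ≤ 0) :
    mink M M < 0 := by
  by_contra! hn
  exact hM ⟨not_lt.1 fun h' => hc.not_gt ((h.time_pos_iff hn).1 h'), hn⟩

/-- Orienting the axes along `M₀ M` instead of `M` makes the ratios nonnegative for either sign of
`M₀`; for `M₀ = 0` they are `0` by the convention on division. -/
theorem coordRatio_nonneg (hu : ∀ i, 0 ≤ -mink (u i) (mink u₀ M • M)) (i : Fin 3) :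
    0 ≤ coordRatio u₀ u M i := by
  rcases eq_or_ne (mink u₀ M) 0 with hc | hc
  · simp [coordRatio, hc]
  · have h1 := hu i
    rw [mink_smul_right] at h1
    have : coordRatio u₀ u M i = -(mink u₀ M * mink (u i) M) / mink u₀ M ^ 2 := by
      rw [coordRatio]; field_simp
    rw [this]
    positivity

theorem nullStationary_encard_le_one_of_nonpos (h : IsEigenframe A l₀ l u₀ u) (hl : ∀ i, l i < l₀)
    (hm : ∀ i, 0 ≤ coordRatio u₀ u M i) (hc : mink u₀ M ≤ 0) :
    (nullStationary A M).encard ≤ 1 := by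
  rcases hc.eq_or_lt with hc | hc
  · refine Set.encard_le_one_iff.2 ?_
    -- For `M₀ = 0` the time equation forces `ζ = l₀`. This fixes the spatial coordinates of `r`,
    -- and nullity fixes the time coordinate.
    have key : ∀ r ∈ nullStationary A M, ∀ i, mink (u i) r = mink (u i) M / (l i - l₀) := by
      rintro r ⟨hr, ζ, hζ⟩ i
      have h1 := ((mem_futureNull_iff h.toIsLorentzFrame).1 hr).1
      have h2 := h.time_eq hζ
      rw [hc] at h2
      have h3 : ζ = l₀ := by
        have := (mul_eq_zero.1 h2).resolve_right h1.ne'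
        linarith
      have h4 := h.space_eq hζ i
      rw [h3] at h4
      rw [eq_div_iff (sub_ne_zero.2 (hl i).ne), mul_comm]
      exact h4
    intro r r' hr hr'
    have hs : ∀ i, mink (u i) r = mink (u i) r' := fun i => (key r hr i).trans (key r' hr' i).symm
    obtain ⟨h1, h2⟩ := (mem_futureNull_iff h.toIsLorentzFrame).1 hr.1
    obtain ⟨h1', h2'⟩ := (mem_futureNull_iff h.toIsLorentzFrame).1 hr'.1
    refine h.ext ?_ hs
    refine (pow_left_inj₀ h1.le h1'.le two_ne_zero).1 ?_
    rw [← sum_sq_eq h.toIsLorentzFrame h2, ← sum_sq_eq h.toIsLorentzFrame h2']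
    simp only [hs]
  · rw [h.nullStationary_encard_neg hc]
    exact neg_encard_le_one (fun i => sub_pos.2 (hl i)) hm

theorem one_le_nullStationary_encard (h : IsEigenframe A l₀ l u₀ u) (hl : ∀ i, l i < l₀)
    (hm : ∀ i, 0 ≤ coordRatio u₀ u M i) (hM : M ∉ pastCone) :
    1 ≤ (nullStationary A M).encard := by
  have hd : ∀ i, 0 < l₀ - l i := fun i => sub_pos.2 (hl i)
  rcases lt_trichotomy (mink u₀ M) 0 with hc | hc | hc
  · rw [h.nullStationary_encard_neg hc, Set.one_le_encard_iff_nonempty]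
    have h1 := mink_self_neg h.toIsLorentzFrame hM hc.le
    rw [mink_self_eq h.toIsLorentzFrame hc.ne] at h1
    have h2 := neg_of_mul_neg_right h1 (by positivity)
    obtain ⟨x, hx⟩ := exists_neg_mem_normalSolutions hd hm (by linarith)
    exact ⟨x, hx⟩
  · rw [Set.one_le_encard_iff_nonempty]
    have h1 := mink_self_neg h.toIsLorentzFrame hM hc.le
    rw [h.mink_eq_coords, hc] at h1
    simp only [← sq] at h1
    have hne : ∃ j, mink (u j) M ≠ 0 := by
      by_contra! hn
      simp [hn] at h1
    obtain ⟨j, hj⟩ := hne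
    -- With `M₀ = 0` and multiplier `l₀` the spatial equations can be solved explicitly; the time
    -- coordinate is chosen to make `r` null, and it is nonzero because `M` is spacelike.
    set s : Fin 3 → ℝ := fun i => mink (u i) M / (l₀ - l i) with hs
    have hsj : s j ≠ 0 := div_ne_zero hj (hd j).ne'
    have hspos : 0 < ∑ i, s i ^ 2 := by
      refine Finset.sum_pos' (fun i _ => sq_nonneg _) ⟨j, Finset.mem_univ j, by positivity⟩
    set r : FourVec := Real.sqrt (∑ i, s i ^ 2) • u₀ + ∑ i, s i • u i with hr
    have e0 : mink u₀ r = Real.sqrt (∑ i, s i ^ 2) := h.mink_zero_combination _ _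
    have ei : ∀ i, mink (u i) r = - s i := fun i => h.mink_combination _ _ i
    refine ⟨r, (mem_futureNull_iff h.toIsLorentzFrame).2 ⟨?_, ?_⟩, l₀, h.ext ?_ fun i => ?_⟩
    · rw [e0]; exact Real.sqrt_pos.2 hspos
    · rw [h.mink_eq_coords, e0, Real.mul_self_sqrt hspos.le]
      simp only [ei, neg_neg, ← sq, sub_self]
    · rw [mink_sub_right, mink_smul_right, h.mink_zero_mulVec, hc, sub_zero]
    · rw [mink_sub_right, mink_smul_right, h.mink_mulVec, ei, hs]
      have := (hd i).ne'
      field_simp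
      ring
  · rw [h.nullStationary_encard_pos hc, Set.one_le_encard_iff_nonempty]
    obtain ⟨x, hx⟩ := exists_mem_branch_neg_one hd hm
    exact ⟨x, hx.1, pos_of_mem_branch (i := 0) hd hx rfl⟩

theorem two_le_nullStationary_encard (h : IsEigenframe A l₀ l u₀ u) (hl : ∀ i, l i < l₀)
    (hm : ∀ i, 0 ≤ coordRatio u₀ u M i) (hM : M ∈ insideFutureCone) :
    2 ≤ (nullStationary A M).encard := by
  have hd : ∀ i, 0 < l₀ - l i := fun i => sub_pos.2 (hl i)
  obtain ⟨hc, hs⟩ := (mem_insideFutureCone_iff h.toIsLorentzFrame).1 hM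
  rw [h.nullStationary_encard_pos hc]
  obtain ⟨x, hx⟩ := exists_mem_branch_neg_one hd hm
  obtain ⟨y, hy, hy0⟩ := exists_pos_mem_branch_one hd hm hs
  have hne : x ≠ y := by
    rintro rfl
    -- A solution with both the all-plus and the all-minus pattern would have `n = 0`.
    have h0 : ∀ i, x.2 i = 0 := by
      intro i
      have h1 := (hx.2 i).1
      have h2 := (hy.2 i).1
      linarith
    have := hx.1.1
    simp [h0] at this
  rw [← Set.encard_pair hne]
  exact Set.encard_le_encard (Set.pair_subset ⟨hx.1, pos_of_mem_branch (i := 0) hd hx rfl⟩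
    ⟨hy.1, hy0⟩)

/-! ### Caustic cones in terms of solutions. -/

/-- The parametrization `M = A r - l r` of the cone is the neutral equation with multiplier `l`, and
`l_j ≤ l ≤ l_k` places `t = 1 / (l₀ - l)` between `1 / d_j` and `1 / d_k`. As `l < l₀`, such `M`
have `M₀ > 0`. -/
theorem mem_causticCone_iff (h : IsEigenframe (mixed Λ) l₀ l u₀ u) (hl : ∀ i, l i < l₀)
    (j k : Fin 3) : M ∈ causticCone Λ (l j) (l k) ↔ 0 < mink u₀ M ∧
      ∃ x ∈ normalSolutions (fun i => l₀ - l i) (coordRatio u₀ u M),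
        1 - (l₀ - l j) * x.1 ≤ 0 ∧ 0 ≤ 1 - (l₀ - l k) * x.1 := by
  constructor
  · rintro ⟨r, hr, ζ, ⟨hζ1, hζ2⟩, rfl⟩
    have hlt : 0 < l₀ - ζ := sub_pos.2 (hζ2.trans_lt (hl k))
    have he : (mixed Λ).mulVec r - ((mixed Λ).mulVec r - ζ • r) = ζ • r := sub_sub_cancel _ _
    have hc : 0 < mink u₀ ((mixed Λ).mulVec r - ζ • r) := by
      rw [← h.time_eq he]
      exact mul_pos hlt ((mem_futureNull_iff h.toIsLorentzFrame).1 hr).1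
    obtain ⟨x, hx, hx1, -, -⟩ := h.exists_solution hc.ne' hr he
    refine ⟨hc, x, hx, ?_, ?_⟩
    · rw [hx1, ← div_eq_mul_inv, sub_nonpos, one_le_div hlt]
      linarith
    · rw [hx1, ← div_eq_mul_inv, sub_nonneg, div_le_one hlt]
      linarith
  · rintro ⟨hc, x, hx, h1, h2⟩
    have hx0 : 0 < x.1 := pos_of_mul_pos_right (by linarith : 0 < (l₀ - l j) * x.1)
      (sub_pos.2 (hl j)).le
    obtain ⟨h3, h4⟩ := h.toNull_mem hx (mul_pos hc hx0)
    refine ⟨_, h3, l₀ - x.1⁻¹, ⟨?_, ?_⟩, ?_⟩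
    · have : x.1⁻¹ ≤ l₀ - l j := by
        rw [inv_le_iff_one_le_mul₀ hx0]; linarith
      linarith
    · have : l₀ - l k ≤ x.1⁻¹ := by
        rw [le_inv_comm₀ (sub_pos.2 (hl k)) hx0, ← one_div, le_div_iff₀ (sub_pos.2 (hl k))]
        linarith
      linarith
    · rw [← h4]; abel

theorem mem_causticCone_one (h : IsEigenframe (mixed Λ) l₀ l u₀ u) (hl : ∀ i, l i < l₀)
    (hlm : StrictMono l) : M ∈ causticCone Λ (l 0) (l 1) ↔ 0 < mink u₀ M ∧
      HasSolution (fun i => l₀ - l i) (coordRatio u₀ u M) 1 := by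
  rw [h.mem_causticCone_iff hl]
  refine and_congr_right fun _ => exists_congr fun x => and_congr_right fun _ => ?_
  rw [forall_signPattern_one]
  refine ⟨fun ⟨h1, h2⟩ => ⟨h1, h2, ?_⟩, fun ⟨h1, h2, _⟩ => ⟨h1, h2⟩⟩
  have hx0 : 0 < x.1 := pos_of_mul_pos_right (by linarith : 0 < (l₀ - l 0) * x.1)
    (sub_pos.2 (hl 0)).le
  have : l 1 < l 2 := hlm (by decide)
  nlinarith

theorem mem_causticCone_two (h : IsEigenframe (mixed Λ) l₀ l u₀ u) (hl : ∀ i, l i < l₀)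
    (hlm : StrictMono l) : M ∈ causticCone Λ (l 1) (l 2) ↔ 0 < mink u₀ M ∧
      HasSolution (fun i => l₀ - l i) (coordRatio u₀ u M) 2 := by
  rw [h.mem_causticCone_iff hl]
  refine and_congr_right fun _ => exists_congr fun x => and_congr_right fun _ => ?_
  rw [forall_signPattern_two]
  refine ⟨fun ⟨h1, h2⟩ => ⟨?_, h1, h2⟩, fun ⟨_, h1, h2⟩ => ⟨h1, h2⟩⟩
  have hx0 : 0 < x.1 := pos_of_mul_pos_right (by linarith : 0 < (l₀ - l 1) * x.1)
    (sub_pos.2 (hl 1)).le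
  have : l 0 < l 1 := hlm (by decide)
  nlinarith

/-- Inside a cone described by solutions of one sign pattern there are short vectors. -/
theorem hasShort_of_mem_interior (h : IsLorentzFrame u₀ u) {d : Fin 3 → ℝ} {C : Set FourVec}
    {k : Fin 4} (hC : ∀ M ∈ C, 0 < mink u₀ M ∧ HasSolution d (coordRatio u₀ u M) k) {t₁ : ℝ}
    (ht₁ : ∀ i, 0 < signPattern k i * (1 - d i * t₁)) (hM : M ∈ interior C) :
    HasShort d (coordRatio u₀ u M) k := by
  -- Adding `s w` multiplies the spatial part of `M` by `1 + s` and keeps its time coordinate. A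
  -- unit solution for the stretched vector, divided by `1 + s`, solves the equation for `M` and is
  -- short.
  set w : FourVec := ∑ i, (-mink (u i) M) • u i with hw
  have hcont : Continuous fun s : ℝ => M + s • w := by fun_prop
  have e1 : ∀ᶠ s in nhdsWithin (0 : ℝ) (Set.Ioi 0), M + s • w ∈ C := by
    refine Filter.Eventually.filter_mono nhdsWithin_le_nhds ?_
    refine hcont.continuousAt.eventually ?_
    simpa using mem_interior_iff_mem_nhds.1 hM
  obtain ⟨s, hs, hs0⟩ := (e1.and self_mem_nhdsWithin).exists
  have hs1 : 0 < 1 + s := by have : 0 < s := hs0; linarith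
  have w0 : mink u₀ w = 0 := by
    rw [hw, ← zero_add (∑ i, _), ← zero_smul ℝ u₀, h.mink_zero_combination]
  have wi : ∀ i, mink (u i) w = mink (u i) M := by
    intro i
    rw [hw, ← zero_add (∑ i, _), ← zero_smul ℝ u₀, h.mink_combination, neg_neg]
  obtain ⟨hc, x, ⟨hx1, hx2⟩, hxs⟩ := hC _ hs
  have hq : ∑ i, (x.2 i / (1 + s)) ^ 2 < 1 := by
    simp only [div_pow]
    rw [← Finset.sum_div, hx1, div_lt_one (by positivity)]
    have : 0 < s := hs0
    nlinarith
  have hmq : ∀ i, coordRatio u₀ u M i = (1 - d i * x.1) * (x.2 i / (1 + s)) := by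
    intro i
    have h3 := hx2 i
    simp only [coordRatio, mink_add_right, mink_smul_right, w0, wi, mul_zero, add_zero] at h3
    rw [mul_div_assoc', eq_div_iff hs1.ne', ← h3, coordRatio]
    ring
  obtain ⟨t, h1, h2⟩ := exists_isShortAt_of_shrunk hq hmq hxs ht₁
  exact ⟨t, h1, fun i => (h2 i).le⟩

/-- Conversely, a neighbourhood of the time axis belongs to such a cone. -/
theorem mem_interior_of_hasSolution (h : IsLorentzFrame u₀ u) {d : Fin 3 → ℝ} {C : Set FourVec}
    {k : Fin 4} (hC : ∀ M, 0 < mink u₀ M → HasSolution d (coordRatio u₀ u M) k → M ∈ C)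
    (hk : ∀ m : Fin 3 → ℝ, HasShort d (fun i => |m i|) k → HasSolution d (fun i => |m i|) k) {t₁ : ℝ}
    (ht₁ : ∀ i, 0 < signPattern k i * (1 - d i * t₁)) : u₀ ∈ interior C := by
  have hcm : ∀ v : FourVec, Continuous (mink v) := fun v => by
    simp only [funext (mink_eq v)]; fun_prop
  rw [mem_interior_iff_mem_nhds]
  have hne : ∀ i, 1 - d i * t₁ ≠ 0 := fun i h' => by have := ht₁ i; simp [h'] at this
  have e1 : ∀ᶠ M in nhds u₀, 0 < mink u₀ M :=
    (hcm u₀).continuousAt.eventually (lt_mem_nhds (by rw [h.unit]; exact one_pos))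
  -- All ratios vanish at `u₀`, so near it the vector at `t₁` is short. The frame is fixed here
  -- while signs of the ratios vary with `M`; hence the absolute values, undone below by
  -- reflections.
  have e2 : ∀ᶠ M in nhds u₀, ∑ i, (|coordRatio u₀ u M i| / (1 - d i * t₁)) ^ 2 < 1 := by
    have hc : ContinuousAt (fun M => ∑ i, (|coordRatio u₀ u M i| / (1 - d i * t₁)) ^ 2) u₀ := by
      refine tendsto_finsetSum _ fun i _ => ?_
      have : ContinuousAt (fun M => coordRatio u₀ u M i) u₀ :=
        (hcm (u i)).neg.continuousAt.div (hcm u₀).continuousAt (by rw [h.unit]; exact one_ne_zero)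
      exact (this.abs.div_const _).pow 2
    refine hc.eventually (gt_mem_nhds ?_)
    simp [coordRatio, mink_comm _ u₀, h.orth₀]
  filter_upwards [e1, e2] with M h1 h2
  refine hC M h1 ?_
  obtain ⟨⟨t, n⟩, hx, hxs⟩ := hk _ ⟨t₁, ⟨hne, h2⟩, fun i => (ht₁ i).le⟩
  obtain ⟨n', hn'⟩ := exists_normalSolution_of_abs hx
  exact ⟨(t, n'), hn', hxs⟩

end IsEigenframe

/-! ### Interior parameters, charge-breaking points and choice of frame. -/

theorem hasSolution_one_of_hasShort {d m : Fin 3 → ℝ} (hd : StrictAnti d) (hd2 : 0 < d 2)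
    (hm : ∀ i, 0 ≤ m i) (h : HasShort d m 1) : HasSolution d m 1 := by
  obtain ⟨t, ht, hs⟩ := h
  have h1 := branch_one_encard hd hd2 hm ht hs
  obtain ⟨x, hx⟩ := Set.encard_ne_zero.1 (by rw [h1]; norm_num)
  exact ⟨x, hx.1, fun i => (hx.2 i).2⟩

theorem hasSolution_two_of_hasShort {d m : Fin 3 → ℝ} (hd : StrictAnti d) (hd2 : 0 < d 2)
    (hm : ∀ i, 0 ≤ m i) (h : HasShort d m 2) : HasSolution d m 2 := by
  obtain ⟨t, ht, hs⟩ := h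
  have h1 := branch_two_encard hd hd2 hm ht hs
  obtain ⟨x, hx⟩ := Set.encard_ne_zero.1 (by rw [h1]; norm_num)
  exact ⟨x, hx.1, fun i => (hx.2 i).2⟩

theorem exists_interior_one {d : Fin 3 → ℝ} (hd : StrictAnti d) (hd2 : 0 < d 2) :
    ∃ t, ∀ i, 0 < signPattern 1 i * (1 - d i * t) := by
  have h01 : d 1 < d 0 := hd (by decide)
  have h12 : d 2 < d 1 := hd (by decide)
  have hs : 0 < d 0 + d 1 := by linarith
  -- The reciprocal of the mean of `d 0` and `d 1` lies strictly between their reciprocals.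
  refine ⟨2 / (d 0 + d 1), ?_⟩
  rw [Fin.forall_fin_succ, Fin.forall_fin_two]
  have h1 : 1 < d 0 * (2 / (d 0 + d 1)) := by
    rw [← mul_div_assoc, one_lt_div hs]; linarith
  have h2 : d 1 * (2 / (d 0 + d 1)) < 1 := by
    rw [← mul_div_assoc, div_lt_one hs]; linarith
  have h3 : d 2 * (2 / (d 0 + d 1)) < 1 := by
    rw [← mul_div_assoc, div_lt_one hs]; linarith
  simp [signPattern, h1, h2, h3]

theorem exists_interior_two {d : Fin 3 → ℝ} (hd : StrictAnti d) (hd2 : 0 < d 2) :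
    ∃ t, ∀ i, 0 < signPattern 2 i * (1 - d i * t) := by
  have h01 : d 1 < d 0 := hd (by decide)
  have h12 : d 2 < d 1 := hd (by decide)
  have hs : 0 < d 1 + d 2 := by linarith
  refine ⟨2 / (d 1 + d 2), ?_⟩
  rw [Fin.forall_fin_succ, Fin.forall_fin_two]
  have h1 : 1 < d 0 * (2 / (d 1 + d 2)) := by
    rw [← mul_div_assoc, one_lt_div hs]; linarith
  have h2 : 1 < d 1 * (2 / (d 1 + d 2)) := by
    rw [← mul_div_assoc, one_lt_div hs]; linarith
  have h3 : d 2 * (2 / (d 1 + d 2)) < 1 := by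
    rw [← mul_div_assoc, div_lt_one hs]; linarith
  simp [signPattern, h1, h2, h3]

theorem neutralPoints_eq_nullStationary {Λ : Matrix (Fin 4) (Fin 4) ℝ} (hs : Λ.IsSymm)
    (M : FourVec) : neutralPoints Λ M = nullStationary (mixed Λ) M :=
  neutralPoints_eq hs M

theorem mulVec_mixed_injective {Λ : Matrix (Fin 4) (Fin 4) ℝ} (hdet : Λ.det ≠ 0) :
    Function.Injective (mixed Λ).mulVec := by
  refine Matrix.mulVec_injective_of_isUnit ?_
  rw [Matrix.isUnit_iff_isUnit_det, mixed, Matrix.det_mul, isUnit_iff_ne_zero]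
  refine mul_ne_zero hdet ?_
  simp [metric, Matrix.det_diagonal, Fin.prod_univ_four]

theorem chargedPoints_encard_le_one {Λ : Matrix (Fin 4) (Fin 4) ℝ} (hs : Λ.IsSymm)
    (hdet : Λ.det ≠ 0) (M : FourVec) : (chargedPoints Λ M).encard ≤ 1 := by
  rw [chargedPoints_eq hs]
  exact Set.encard_le_one_iff.2 fun r r' hr hr' =>
    mulVec_mixed_injective hdet (hr.2.trans hr'.2.symm)

/-- Three different spacelike eigenvalues are the spatial eigenvalues of an eigenframe, whose
spatial axes can be oriented along any given vector. -/
theorem exists_sorted_eigenframe {Λ : Matrix (Fin 4) (Fin 4) ℝ} (hs : Λ.IsSymm)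
    (hpos : PosDefOnFutureCone Λ) {Λ₁ Λ₂ Λ₃ : ℝ} (h12 : Λ₁ < Λ₂) (h23 : Λ₂ < Λ₃)
    (h1 : IsSpacelikeEigenvalue Λ Λ₁) (h2 : IsSpacelikeEigenvalue Λ Λ₂)
    (h3 : IsSpacelikeEigenvalue Λ Λ₃) :
    ∃ (l₀ : ℝ) (l : Fin 3 → ℝ) (u₀ : FourVec), 0 < l₀ ∧ StrictMono l ∧ l 0 = Λ₁ ∧ l 1 = Λ₂ ∧
      l 2 = Λ₃ ∧ (∀ i, l i < l₀) ∧
      ∀ x, ∃ u, IsEigenframe (mixed Λ) l₀ l u₀ u ∧ ∀ i, 0 ≤ -mink (u i) x := by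
  obtain ⟨l₀, l, u₀, u, hl₀, hl, h⟩ := exists_isEigenframe hs hpos
  obtain ⟨i, rfl⟩ := h.exists_eq hs h1
  obtain ⟨j, rfl⟩ := h.exists_eq hs h2
  obtain ⟨k, rfl⟩ := h.exists_eq hs h3
  have hmono : StrictMono (l ∘ ![i, j, k]) := by
    rw [Fin.strictMono_iff_lt_succ, Fin.forall_fin_two]
    exact ⟨h12, h23⟩
  exact ⟨l₀, l ∘ ![i, j, k], u₀, hl₀, hmono, rfl, rfl, rfl, fun a => hl _,
    fun x => h.reindex hmono.injective.of_comp x⟩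

theorem exists_eigenframe_coordRatio_nonneg {Λ : Matrix (Fin 4) (Fin 4) ℝ} (hs : Λ.IsSymm)
    (hpos : PosDefOnFutureCone Λ) (M : FourVec) : ∃ (l₀ : ℝ) (l : Fin 3 → ℝ) (u₀ : FourVec)
      (u : Fin 3 → FourVec), (∀ i, l i < l₀) ∧ IsEigenframe (mixed Λ) l₀ l u₀ u ∧
      ∀ i, 0 ≤ coordRatio u₀ u M i := by
  obtain ⟨l₀, l, u₀, u, -, hl, h⟩ := exists_isEigenframe hs hpos
  obtain ⟨u', h', hu'⟩ := h.reindex (π := id) Function.injective_id (mink u₀ M • M)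
  exact ⟨l₀, l, u₀, u', hl, h', IsEigenframe.coordRatio_nonneg hu'⟩

end TwoHiggs

theorem mainTheorem3 (Λ : Matrix (Fin 4) (Fin 4) ℝ) (hsymm : Λ.IsSymm)
    (hpos : TwoHiggs.PosDefOnFutureCone Λ) :
    -- outside the past light-cone: at least one neutral stationary point
    (∀ M : TwoHiggs.FourVec, M ∉ TwoHiggs.pastCone → 1 ≤ (TwoHiggs.neutralPoints Λ M).encard) ∧
    -- inside the future light-cone: at least two
    (∀ M ∈ TwoHiggs.insideFutureCone, 2 ≤ (TwoHiggs.neutralPoints Λ M).encard) ∧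
    -- the caustic cones, for three different spacelike eigenvalues
    (∀ Λ₁ Λ₂ Λ₃ : ℝ, Λ₁ < Λ₂ → Λ₂ < Λ₃ → TwoHiggs.IsSpacelikeEigenvalue Λ Λ₁ →
      TwoHiggs.IsSpacelikeEigenvalue Λ Λ₂ → TwoHiggs.IsSpacelikeEigenvalue Λ Λ₃ →
      -- outside both caustic cones nothing is added
      (∀ M : TwoHiggs.FourVec, M ∉ TwoHiggs.pastCone →
        M ∉ closure (TwoHiggs.causticCone Λ Λ₁ Λ₂) → M ∉ closure (TwoHiggs.causticCone Λ Λ₂ Λ₃) →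
        (TwoHiggs.neutralPoints Λ M).encard = TwoHiggs.baseNumber M) ∧
      -- inside one caustic cone: at least two more, wherever `M` lies relative to the other cone
      (∀ M : TwoHiggs.FourVec,
        M ∈ interior (TwoHiggs.causticCone Λ Λ₁ Λ₂) ∨
          M ∈ interior (TwoHiggs.causticCone Λ Λ₂ Λ₃) →
        TwoHiggs.baseNumber M + 2 ≤ (TwoHiggs.neutralPoints Λ M).encard) ∧
      -- inside one caustic cone and outside the other one: exactly two more
      (∀ M : TwoHiggs.FourVec,
        (M ∈ interior (TwoHiggs.causticCone Λ Λ₁ Λ₂) ∧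
            M ∉ closure (TwoHiggs.causticCone Λ Λ₂ Λ₃)) ∨
          (M ∈ interior (TwoHiggs.causticCone Λ Λ₂ Λ₃) ∧
            M ∉ closure (TwoHiggs.causticCone Λ Λ₁ Λ₂)) →
        (TwoHiggs.neutralPoints Λ M).encard = TwoHiggs.baseNumber M + 2) ∧
      -- inside both caustic cones: exactly four more
      (∀ M : TwoHiggs.FourVec,
        M ∈ interior (TwoHiggs.causticCone Λ Λ₁ Λ₂) →
        M ∈ interior (TwoHiggs.causticCone Λ Λ₂ Λ₃) →
        (TwoHiggs.neutralPoints Λ M).encard = TwoHiggs.baseNumber M + 4) ∧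
      -- never more than six neutral and, for invertible `Λ`, one charge-breaking stationary point
      (∀ M : TwoHiggs.FourVec, (TwoHiggs.neutralPoints Λ M).encard ≤ 6 ∧
        (Λ.det ≠ 0 → (TwoHiggs.chargedPoints Λ M).encard ≤ 1)) ∧
      -- and these numbers are reached together, inside the light-cone and both caustic cones
      (∃ M ∈ TwoHiggs.insideFutureCone,
        M ∈ interior (TwoHiggs.causticCone Λ Λ₁ Λ₂) ∧
        M ∈ interior (TwoHiggs.causticCone Λ Λ₂ Λ₃) ∧
        (TwoHiggs.neutralPoints Λ M).encard = 6 ∧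
        (Λ.det ≠ 0 → (TwoHiggs.chargedPoints Λ M).encard = 1))) := by
  open TwoHiggs in
  refine ⟨fun M hM => ?_, fun M hM => ?_, ?_⟩
  · obtain ⟨l₀, l, u₀, u, hl, h, hm⟩ := exists_eigenframe_coordRatio_nonneg hsymm hpos M
    rw [neutralPoints_eq_nullStationary hsymm]
    exact h.one_le_nullStationary_encard hl hm hM
  · obtain ⟨l₀, l, u₀, u, hl, h, hm⟩ := exists_eigenframe_coordRatio_nonneg hsymm hpos M
    rw [neutralPoints_eq_nullStationary hsymm]
    exact h.two_le_nullStationary_encard hl hm hM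
  intro Λ₁ Λ₂ Λ₃ h12 h23 e1 e2 e3
  obtain ⟨l₀, l, u₀, hl₀, hlm, rfl, rfl, rfl, hl, hframe⟩ :=
    exists_sorted_eigenframe hsymm hpos h12 h23 e1 e2 e3
  -- Increasing eigenvalues give decreasing `dᵢ`, hence poles `1 / dᵢ` in increasing order.
  have hd : StrictAnti fun i => l₀ - l i := fun i j hij => sub_lt_sub_left (hlm hij) l₀
  have hd2 : 0 < l₀ - l 2 := sub_pos.2 (hl 2)
  have hF : ∀ M, ∃ u, IsEigenframe (mixed Λ) l₀ l u₀ u ∧ ∀ i, 0 ≤ coordRatio u₀ u M i := by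
    intro M
    obtain ⟨u, hu, hu'⟩ := hframe (mink u₀ M • M)
    exact ⟨u, hu, IsEigenframe.coordRatio_nonneg hu'⟩
  obtain ⟨t₁, ht₁⟩ := exists_interior_one hd hd2
  obtain ⟨t₂, ht₂⟩ := exists_interior_two hd hd2
  have inside1 : ∀ {M u}, IsEigenframe (mixed Λ) l₀ l u₀ u →
      M ∈ interior (causticCone Λ (l 0) (l 1)) →
      0 < mink u₀ M ∧ HasShort (fun i => l₀ - l i) (coordRatio u₀ u M) 1 := fun h hM =>
    ⟨((h.mem_causticCone_one hl hlm).1 (interior_subset hM)).1,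
      IsEigenframe.hasShort_of_mem_interior h.toIsLorentzFrame
        (fun _ h' => (h.mem_causticCone_one hl hlm).1 h') ht₁ hM⟩
  have inside2 : ∀ {M u}, IsEigenframe (mixed Λ) l₀ l u₀ u →
      M ∈ interior (causticCone Λ (l 1) (l 2)) →
      0 < mink u₀ M ∧ HasShort (fun i => l₀ - l i) (coordRatio u₀ u M) 2 := fun h hM =>
    ⟨((h.mem_causticCone_two hl hlm).1 (interior_subset hM)).1,
      IsEigenframe.hasShort_of_mem_interior h.toIsLorentzFrame
        (fun _ h' => (h.mem_causticCone_two hl hlm).1 h') ht₂ hM⟩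
  have outside1 : ∀ {M u}, IsEigenframe (mixed Λ) l₀ l u₀ u → 0 < mink u₀ M →
      M ∉ closure (causticCone Λ (l 0) (l 1)) →
      ¬ HasSolution (fun i => l₀ - l i) (coordRatio u₀ u M) 1 := fun h hc hM h' =>
    hM (subset_closure ((h.mem_causticCone_one hl hlm).2 ⟨hc, h'⟩))
  have outside2 : ∀ {M u}, IsEigenframe (mixed Λ) l₀ l u₀ u → 0 < mink u₀ M →
      M ∉ closure (causticCone Λ (l 1) (l 2)) →
      ¬ HasSolution (fun i => l₀ - l i) (coordRatio u₀ u M) 2 := fun h hc hM h' =>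
    hM (subset_closure ((h.mem_causticCone_two hl hlm).2 ⟨hc, h'⟩))
  have both : ∀ M : FourVec, M ∈ interior (causticCone Λ (l 0) (l 1)) →
      M ∈ interior (causticCone Λ (l 1) (l 2)) →
      (neutralPoints Λ M).encard = baseNumber M + 4 := by
    intro M hM1 hM2
    obtain ⟨u, h, hm⟩ := hF M
    obtain ⟨hc, h1⟩ := inside1 h hM1
    rw [neutralPoints_eq_nullStationary hsymm, h.nullStationary_encard_pos hc,
      IsEigenframe.baseNumber_eq h.toIsLorentzFrame hc]
    exact posSolutions_encard_of_both hd hd2 hm h1 (inside2 h hM2).2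
  refine ⟨fun M hM hM1 hM2 => ?_, fun M hM => ?_, fun M hM => ?_, both, fun M => ⟨?_, fun hdet =>
    chargedPoints_encard_le_one hsymm hdet M⟩, ?_⟩
  · obtain ⟨u, h, hm⟩ := hF M
    rw [neutralPoints_eq_nullStationary hsymm]
    -- For `M₀ ≤ 0` the vector is not inside the future cone, so the base number is `1`, and there
    -- is exactly one solution without reference to the caustics.
    rcases lt_or_ge 0 (mink u₀ M) with hc | hc
    · rw [h.nullStationary_encard_pos hc, IsEigenframe.baseNumber_eq h.toIsLorentzFrame hc]
      exact posSolutions_encard_of_not hd hd2 hm (outside1 h hc hM1) (outside2 h hc hM2)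
    · rw [IsEigenframe.baseNumber_eq_one h.toIsLorentzFrame hc]
      exact le_antisymm (h.nullStationary_encard_le_one_of_nonpos hl hm hc)
        (h.one_le_nullStationary_encard hl hm hM)
  · obtain ⟨u, h, hm⟩ := hF M
    have hc : 0 < mink u₀ M := hM.elim (fun h' => (inside1 h h').1) fun h' => (inside2 h h').1
    rw [neutralPoints_eq_nullStationary hsymm, h.nullStationary_encard_pos hc,
      IsEigenframe.baseNumber_eq h.toIsLorentzFrame hc]
    exact le_posSolutions_encard hd hd2 hm
      (hM.imp (fun h' => (inside1 h h').2) fun h' => (inside2 h h').2)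
  · obtain ⟨u, h, hm⟩ := hF M
    have hc : 0 < mink u₀ M :=
      hM.elim (fun h' => (inside1 h h'.1).1) fun h' => (inside2 h h'.1).1
    rw [neutralPoints_eq_nullStationary hsymm, h.nullStationary_encard_pos hc,
      IsEigenframe.baseNumber_eq h.toIsLorentzFrame hc]
    exact posSolutions_encard_of_one hd hd2 hm
      (hM.imp (fun h' => ⟨(inside1 h h'.1).2, outside2 h hc h'.2⟩)
        fun h' => ⟨(inside2 h h'.1).2, outside1 h hc h'.2⟩)
  · obtain ⟨u, h, hm⟩ := hF M
    rw [neutralPoints_eq_nullStationary hsymm]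
    rcases lt_or_ge 0 (mink u₀ M) with hc | hc
    · rw [h.nullStationary_encard_pos hc]
      exact posSolutions_encard_le_six hd hd2 hm
    · exact (h.nullStationary_encard_le_one_of_nonpos hl hm hc).trans (by norm_num)
  -- The timelike eigenvector serves as `M`: it lies inside all three cones, and `u₀ / l₀` is its
  -- charge-breaking point.
  · obtain ⟨u, h, -⟩ := hF u₀
    have hu₀ : u₀ ∈ insideFutureCone := ⟨h.pos, by rw [h.unit]; exact one_pos⟩
    have i1 : u₀ ∈ interior (causticCone Λ (l 0) (l 1)) :=
      IsEigenframe.mem_interior_of_hasSolution h.toIsLorentzFrame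
        (fun _ hc h' => (h.mem_causticCone_one hl hlm).2 ⟨hc, h'⟩)
        (fun m => hasSolution_one_of_hasShort hd hd2 fun i => abs_nonneg (m i)) ht₁
    have i2 : u₀ ∈ interior (causticCone Λ (l 1) (l 2)) :=
      IsEigenframe.mem_interior_of_hasSolution h.toIsLorentzFrame
        (fun _ hc h' => (h.mem_causticCone_two hl hlm).2 ⟨hc, h'⟩)
        (fun m => hasSolution_two_of_hasShort hd hd2 fun i => abs_nonneg (m i)) ht₂
    refine ⟨u₀, hu₀, i1, i2, ?_, fun hdet => le_antisymm
      (chargedPoints_encard_le_one hsymm hdet u₀) ?_⟩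
    · rw [both u₀ i1 i2, baseNumber, if_pos hu₀]
      norm_num
    · rw [Set.one_le_encard_iff_nonempty, chargedPoints_eq hsymm]
      refine ⟨l₀⁻¹ • u₀, ⟨?_, ?_⟩, ?_⟩
      · have := h.pos
        simp only [Pi.smul_apply, smul_eq_mul]
        positivity
      · rw [mink_smul_left, mink_smul_right, h.unit]
        positivity
      · rw [Matrix.mulVec_smul, h.eig₀, smul_smul, inv_mul_cancel₀ hl₀.ne', one_smul]
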